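/- Let $1<k\le n$. A network is a directed graph $G$ without self-loops whose $n+1$ nodes are a dealer $D$ and participants $1,\dots,n$ (an undirected edge is a pair of opposite directed edges); every edge is a private link. Write $\deg(\ell)$ for the number of edges coming into participant $\ell$, and call $\ell$ adjacent to the dealer if there is an edge from $D$ to $\ell$. A protocol on $G$ runs for finitely many rounds. In each round every node sends, along each outgoing edge, a message from a finite alphabet (one message may stand for silence) that is a function of its private coins, the messages it received in earlier rounds and, for the dealer, the secret $S$. The secret takes values in a finite set $A$, and $S$ and the coins of the different nodes are independent. The protocol performs $(n,k)$ secret sharing of $S$ if (i) the data downloaded (i.e. received) by any $k$ participants determines $S$ with probability one, and (ii) all the data known to fewer than $k$ participants (their coins and all they downloaded) is jointly independent of $S$. If $X_{u\ell}$ denotes all the data passed over the edge $u\to\ell$, then the download of $\ell$, in units of the secret, is $\Gamma(\ell)=\sum_{u\to\ell}H(X_{u\ell})/H(S)$, where $H$ is Shannon entropy and $H(S)>0$ is assumed. **Lower bound.** For every network $G$, every participant $\ell$, every secret $S$ with $H(S)>0$ and every protocol on $G$ performing $(n,k)$ secret sharing of $S$: * if $\ell$ is not adjacent to the dealer and $\deg(\ell)\ge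 k$, then $\Gamma(\ell)\ge \dfrac{\deg(\ell)}{\deg(\ell)-k+1}$; * if $\ell$ is adjacent to the dealer, then $\Gamma(\ell)\ge 1$. If $\ell$ is not adjacent to the dealer and $\deg(\ell)<k$, then no protocol on $G$ performs $(n,k)$ secret sharing of any $S$ with $H(S)>0$. **The bound is the best possible given only the neighbourhood of $\ell$.** For every network $G$ and participant $\ell$ there is a network $G'$ on the same nodes in which $\ell$ has the same in-neighbours and the same out-neighbours as in $G$, such that for every finite field $\mathbb F$ and all distinct nonzero $x_1,\dots,x_n\in\mathbb F$: * if $\ell$ is not adjacent to the dealer and $d:=\deg(\ell)\ge k$, the SNEAK algorithm with parameter $d$ on $G'$, for $S$ uniform on $\mathbb F^{d-k+1}$, performs $(n,k)$ secret sharing, with $\Gamma(\ell)=\frac{d}{d-k+1}$; * if $\ell$ is adjacent to the dealer, then for every $d\ge k$ and $S$ uniform on $\mathbb F^{d-k+1}$, the protocol in which the dealer directly passes to each of its neighbours $j$ the SNEAK share $t_j$, and nothing else is sent, performs $(n,k)$ secret sharing on $G'$, with $\Gamma(\ell)=1$. Both equalities also hold if data is measured by alphabet sizes, i.e. for $\sum_{u\to\ell}\log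 N_{u\ell}/\log|A|$, where $N_{u\ell}$ is the number of possible values of $X_{u\ell}$. *The SNEAK algorithm.* Put $\psi_j=(1,x_j,\dots,x_j^{d-1})^T$. From the secret $(s_1,\dots,s_{d-k+1})$ and independent uniformly random entries the dealer forms the symmetric $d\times d$ matrix $$M=\begin{pmatrix}S_A&R_a^T&S_B^T\\R_a&R_b&R_c^T\\S_B&R_c&0\end{pmatrix},\qquad S_A=s_{d-k+1},\quad S_B=(s_1,\dots,s_{d-k})^T,$$ where the blocks have sizes $1$, $k-1$, $d-k$ and $R_a$, $R_b$ (symmetric), $R_c$ are random. The share $t_j$ consists of the first and the last $d-k$ entries of $\psi_j^TM$. The dealer sends $\psi_j^TM$ to each neighbour $j$. A participant $i$ that is adjacent to the dealer takes $v^T=\psi_i^TM$ as received; any other participant $i$ waits for one symbol each from some $d$ neighbours $i_1,\dots,i_d$ (an arbitrary choice if there are more), forms the vector $\sigma$ of these symbols, and computes $v=\Psi^{-1}\sigma$, where $\Psi$ has rows $\psi_{i_1}^T,\dots,\psi_{i_d}^T$. Once $v$ is known, $i$ sends the symbol $v^T\psi_j$ to each participant $j$ to which it has an edge; if $i$ is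 not adjacent to the dealer, it omits those $j$ from which it has already received data. -/

import Mathlib

noncomputable section

open scoped Classical in
/-- Probability of the event `E` under the probability vector `p` on a finite type. -/
def finProb {Ω : Type*} [Fintype Ω] (p : Ω → ℝ) (E : Ω → Prop) : ℝ :=
  ∑ ω, if E ω then p ω else 0

/-- Shannon entropy (in nats) of the random variable `X` under the probability vector `p`. -/
def shannonEntropy {Ω α : Type*} [Fintype Ω] [Fintype α] (p : Ω → ℝ) (X : Ω → α) : ℝ :=
  ∑ x, Real.negMulLog (finProb p (fun ω => X ω = x))

/-- The uniform probability vector on a finite type. -/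
def uniformLaw (α : Type*) [Fintype α] : α → ℝ := fun _ => 1 / (Fintype.card α : ℝ)

theorem uniformLaw_mem (α : Type*) [Fintype α] [Nonempty α] :
    uniformLaw α ∈ stdSimplex ℝ α := by
  refine ⟨fun _ => by unfold uniformLaw; positivity, ?_⟩
  have h : (Fintype.card α : ℝ) ≠ 0 := by exact_mod_cast Fintype.card_ne_zero
  simp [uniformLaw, h]

/-- The `n + 1` nodes of the network: `none` is the dealer, `some i` is participant `i`. -/
abbrev Node (n : ℕ) : Type := Option (Fin n)

/-- Nodes with an edge into `v`. An undirected edge is a pair of opposite directed edges. -/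
abbrev InNbr {n : ℕ} (G : Digraph (Node n)) (v : Node n) : Type := {u : Node n // G.Adj u v}

/-- Nodes that receive an edge from `v`. -/
abbrev OutNbr {n : ℕ} (G : Digraph (Node n)) (v : Node n) : Type := {w : Node n // G.Adj v w}

/-- Number of edges coming into participant `ℓ`. -/
def inDeg {n : ℕ} (G : Digraph (Node n)) (ℓ : Fin n) : ℕ := Set.ncard {u | G.Adj u (some ℓ)}

/-- A communication protocol on the network `G` for a secret in `A`. It runs for a finite number of
synchronous rounds; in each round every node `v` puts a message on each of its outgoing edges
(one of the messages may stand for silence). The message depends on what `v` knows: its private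
coins, the messages that it received in earlier rounds and, for the dealer, the secret.
A history of received messages is a list with one entry per past round, most recent first. -/
structure Protocol {n : ℕ} (G : Digraph (Node n)) (A : Type) where
  Msg : Type
  [msgFintype : Fintype Msg]
  rounds : ℕ
  DealerCoin : Type
  [dealerCoinFintype : Fintype DealerCoin]
  dealerCoinLaw : DealerCoin → ℝ
  dealerCoinLaw_mem : dealerCoinLaw ∈ stdSimplex ℝ DealerCoin
  Coin : Fin n → Type
  [coinFintype : ∀ i, Fintype (Coin i)]
  coinLaw : ∀ i, Coin i → ℝ
  coinLaw_mem : ∀ i, coinLaw i ∈ stdSimplex ℝ (Coin i)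
  dealerSend : A → DealerCoin → List (InNbr G none → Msg) → OutNbr G none → Msg
  send : ∀ i, Coin i → List (InNbr G (some i) → Msg) → OutNbr G (some i) → Msg

attribute [instance] Protocol.msgFintype Protocol.dealerCoinFintype Protocol.coinFintype

namespace Protocol

variable {n : ℕ} {G : Digraph (Node n)} {A : Type}

/-- An outcome: the secret, the coins of the dealer, and the coins of all participants. -/
abbrev Outcome (P : Protocol G A) : Type := A × P.DealerCoin × (∀ i, P.Coin i)

/-- The secret has law `μ`; it and the coins of the different nodes are independent. -/
def prob (P : Protocol G A) (μ : A → ℝ) (ω : P.Outcome) : ℝ :=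
  μ ω.1 * (P.dealerCoinLaw ω.2.1 * ∏ i, P.coinLaw i (ω.2.2 i))

/-- The messages sent by node `u` after the history `h`. -/
def sendAt (P : Protocol G A) (ω : P.Outcome) :
    (u : Node n) → List (InNbr G u → P.Msg) → OutNbr G u → P.Msg
  | none => P.dealerSend ω.1 ω.2.1
  | some i => P.send i (ω.2.2 i)

/-- `P.hist ω t v` lists the messages that `v` received in the first `t` rounds. -/
def hist (P : Protocol G A) (ω : P.Outcome) : ℕ → (v : Node n) → List (InNbr G v → P.Msg)
  | 0, _ => []
  | t + 1, v => (fun u => P.sendAt ω u.1 (hist P ω t u.1) ⟨v, u.2⟩) :: hist P ω t v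

/-- All the data passed to `v` over the edge from its in-neighbour `u`. -/
def transcript (P : Protocol G A) (ω : P.Outcome) (v : Node n) (u : InNbr G v) :
    Fin P.rounds → P.Msg :=
  fun t => P.sendAt ω u.1 (P.hist ω t u.1) ⟨v, u.2⟩

/-- All the data downloaded by participant `i`. -/
def received (P : Protocol G A) (ω : P.Outcome) (i : Fin n) :
    InNbr G (some i) → Fin P.rounds → P.Msg :=
  P.transcript ω (some i)

/-- Everything participant `i` has access to: its own coins and the data it downloaded. -/
def view (P : Protocol G A) (ω : P.Outcome) (i : Fin n) :
    P.Coin i × (InNbr G (some i) → Fin P.rounds → P.Msg) :=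
  (ω.2.2 i, P.received ω i)

variable [Fintype A]

/-- `P` performs `(n, k)` secret sharing of a secret with law `μ`: the shares (downloaded data) of
any `k` participants determine the secret, and all that is known to fewer than `k` participants
together is independent of the secret. -/
structure IsSecretSharing (P : Protocol G A) (μ : A → ℝ) (k : ℕ) : Prop where
  recovery : ∀ K : Finset (Fin n), K.card = k →
    ∃ decode : (∀ i : K, InNbr G (some i.1) → Fin P.rounds → P.Msg) → A,
      ∀ ω : P.Outcome, 0 < P.prob μ ω → decode (fun i => P.received ω i.1) = ω.1
  secrecy : ∀ J : Finset (Fin n), J.card < k →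
    ∀ (s : A) (w : ∀ i : J, P.Coin i.1 × (InNbr G (some i.1) → Fin P.rounds → P.Msg)),
      finProb (P.prob μ) (fun ω => ω.1 = s ∧ (fun i : J => P.view ω i.1) = w) =
        finProb (P.prob μ) (fun ω => ω.1 = s) *
          finProb (P.prob μ) (fun ω => (fun i : J => P.view ω i.1) = w)

open scoped Classical in
/-- Data downloaded by participant `ℓ`, in units of the secret: the sum of the entropies of the data
passed to `ℓ` over its incoming edges, divided by the entropy of the secret. -/
def download (P : Protocol G A) (μ : A → ℝ) (ℓ : Fin n) : ℝ :=
  (∑ u : InNbr G (some ℓ), shannonEntropy (P.prob μ) (fun ω => P.transcript ω (some ℓ) u)) /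
    shannonEntropy μ id

open scoped Classical in
/-- Data downloaded by participant `ℓ`, measured by alphabet sizes instead of entropies: an edge
that can carry `N` different transcripts counts `log N`, and the secret counts `log |A|`. -/
def sizeDownload (P : Protocol G A) (ℓ : Fin n) : ℝ :=
  (∑ u : InNbr G (some ℓ),
      Real.log (Set.ncard (Set.range fun ω : P.Outcome => P.transcript ω (some ℓ) u))) /
    Real.log (Fintype.card A)

end Protocol

/-! ### The SNEAK algorithm

Parameters `2 ≤ k ≤ d`, a finite field `F`, and distinct nonzero points `x i` of `F`, one for each
participant. The secret is a vector of `d - k + 1` symbols of `F`. -/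

namespace Sneak

/-- Positions `1`, `2, …, k` and `k + 1, …, d` of a vector of length `d`. -/
abbrev Idx (k d : ℕ) : Type := Unit ⊕ Fin (k - 1) ⊕ Fin (d - k)

abbrev Secret (F : Type) (k d : ℕ) : Type := Fin (d - k + 1) → F

/-- The random values `R_a`, `R_b` (symmetric), `R_c` drawn by the dealer. -/
abbrev Rand (F : Type) (k d : ℕ) : Type :=
  (Fin (k - 1) → F) × {R : Matrix (Fin (k - 1)) (Fin (k - 1)) F // R.IsSymm} ×
    Matrix (Fin (d - k)) (Fin (k - 1)) F

/-- The encoding vector `(1, y, …, y ^ (d - 1))`. -/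
def enc {F : Type} [Field F] (k d : ℕ) (y : F) : Idx k d → F
  | .inl _ => 1
  | .inr (.inl a) => y ^ (a.1 + 1)
  | .inr (.inr c) => y ^ (k + c.1)

/-- The symmetric `d × d` matrix with blocks
`S_A, R_aᵀ, S_Bᵀ; R_a, R_b, R_cᵀ; S_B, R_c, 0`, where the last symbol of the secret is `S_A` and
the other symbols are `S_B`. -/
def mat {F : Type} [Field F] {k d : ℕ} (s : Secret F k d) (r : Rand F k d) :
    Matrix (Idx k d) (Idx k d) F
  | .inl _, .inl _ => s (Fin.last (d - k))
  | .inl _, .inr (.inl b) => r.1 b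
  | .inl _, .inr (.inr c) => s c.castSucc
  | .inr (.inl a), .inl _ => r.1 a
  | .inr (.inl a), .inr (.inl b) => r.2.1.1 a b
  | .inr (.inl a), .inr (.inr c) => r.2.2 c a
  | .inr (.inr c), .inl _ => s c.castSucc
  | .inr (.inr c), .inr (.inl b) => r.2.2 c b
  | .inr (.inr _), .inr (.inr _) => 0

/-- The row vector `ψᵀ M` for the encoding vector `ψ` of the point `y`. -/
def row {F : Type} [Field F] {k d : ℕ} (s : Secret F k d) (r : Rand F k d) (y : F) :
    Idx k d → F :=
  Matrix.vecMul (enc k d y) (mat s r)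

/-- The share for the point `y`: the `d - k + 1` entries of `ψᵀ M` in the first column and in the
last `d - k` columns. -/
def share {F : Type} [Field F] {k d : ℕ} (s : Secret F k d) (r : Rand F k d) (y : F) :
    Unit ⊕ Fin (d - k) → F
  | .inl _ => row s r y (.inl ())
  | .inr c => row s r y (.inr (.inr c))

/-- A message: silence (`none`), a vector of length `d` (sent by the dealer), or one symbol. -/
abbrev Msg (F : Type) (k d : ℕ) : Type := Option ((Idx k d → F) ⊕ F)

def Msg.vector? {F : Type} {k d : ℕ} : Msg F k d → Option (Idx k d → F)
  | some (.inl v) => some v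
  | _ => none

def Msg.symbol? {F : Type} {k d : ℕ} : Msg F k d → Option F
  | some (.inr a) => some a
  | _ => none

variable {F : Type} {n k d : ℕ} {G : Digraph (Node n)}

/-- Histories of participant `ℓ`. -/
abbrev Hist (F : Type) (k d : ℕ) (G : Digraph (Node n)) (ℓ : Fin n) : Type :=
  List (InNbr G (some ℓ) → Msg F k d)

open scoped Classical in
/-- The vector that `ℓ` has received from the dealer, if any. -/
def vectorFromDealer {ℓ : Fin n} (h : Hist F k d G ℓ) : Option (Idx k d → F) :=
  if hD : G.Adj none (some ℓ) then h.findSome? (fun m => (m ⟨none, hD⟩).vector?) else none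

open scoped Classical in
/-- The symbol that `ℓ` has received from participant `j`, if any. -/
def symbolFrom {ℓ : Fin n} (h : Hist F k d G ℓ) (j : Fin n) : Option F :=
  if hj : G.Adj (some j) (some ℓ) then h.findSome? (fun m => (m ⟨some j, hj⟩).symbol?) else none

open scoped Classical in
/-- The vector that `ℓ` works with. A neighbour of the dealer gets it from the dealer. Any other
participant waits for symbols from some `d` neighbours `f r` (an arbitrary choice, if there are more
than `d`), and applies the inverse of the matrix of their encoding vectors. -/
def known [Field F] (x : Fin n → F) {ℓ : Fin n} (h : Hist F k d G ℓ) : Option (Idx k d → F) :=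
  if G.Adj none (some ℓ) then vectorFromDealer h
  else if hf : ∃ f : Idx k d ↪ Fin n, ∀ r, (symbolFrom h (f r)).isSome then
    some (Matrix.mulVec (Matrix.of fun r => enc k d (x (hf.choose r)))⁻¹
      (fun r => (symbolFrom h (hf.choose r)).getD 0))
  else none

open scoped Classical in
/-- As soon as the vector `v` is known to `ℓ` (and only then), `ℓ` passes the inner product of `v`
and the encoding vector of `j` to each participant `j` to which it has an edge, except that a
non-neighbour of the dealer passes nothing to those from whom it has received data. -/
def participantSend [Field F] (x : Fin n → F) (ℓ : Fin n) (h : Hist F k d G ℓ) :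
    OutNbr G (some ℓ) → Msg F k d
  | ⟨none, _⟩ => none
  | ⟨some j, _⟩ =>
    match known x h.tail, known x h with
    | none, some v =>
      if G.Adj none (some ℓ) ∨ symbolFrom h j = none then some (.inr (v ⬝ᵥ enc k d (x j)))
      else none
    | _, _ => none

/-- In the first round the dealer passes `ψ_jᵀ M` to each participant `j` to which it has an edge;
it is silent afterwards. -/
def dealerSend [Field F] (x : Fin n → F) (s : Secret F k d) (r : Rand F k d) :
    List (InNbr G none → Msg F k d) → OutNbr G none → Msg F k d
  | [], ⟨some j, _⟩ => some (.inl (row s r (x j)))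
  | _, _ => none

open scoped Classical in
/-- The SNEAK algorithm with parameter `d` on the network `G`. The participants toss no coins. -/
def protocol [Field F] [Fintype F] (G : Digraph (Node n)) (k d : ℕ) (x : Fin n → F) :
    Protocol G (Secret F k d) where
  Msg := Msg F k d
  rounds := n + 1
  DealerCoin := Rand F k d
  dealerCoinLaw := uniformLaw (Rand F k d)
  dealerCoinLaw_mem :=
    haveI : Nonempty (Rand F k d) := ⟨(0, ⟨0, Matrix.isSymm_zero⟩, 0)⟩
    uniformLaw_mem _
  Coin := fun _ => Unit
  coinLaw := fun _ => uniformLaw Unit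
  coinLaw_mem := fun _ => uniformLaw_mem Unit
  dealerSend := dealerSend x
  send := fun ℓ _ h => participantSend x ℓ h

/-- The dealer passes to each neighbour `j` its share only, and then everybody is silent. -/
def directDealerSend [Field F] (x : Fin n → F) (s : Secret F k d) (r : Rand F k d) :
    List (InNbr G none → Option (Unit ⊕ Fin (d - k) → F)) → OutNbr G none →
      Option (Unit ⊕ Fin (d - k) → F)
  | [], ⟨some j, _⟩ => some (share s r (x j))
  | _, _ => none

open scoped Classical in
/-- The SNEAK algorithm without relaying: every neighbour of the dealer downloads just its share
directly from the dealer, and no other data is passed. -/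
def directProtocol [Field F] [Fintype F] (G : Digraph (Node n)) (k d : ℕ) (x : Fin n → F) :
    Protocol G (Secret F k d) where
  Msg := Option (Unit ⊕ Fin (d - k) → F)
  rounds := 1
  DealerCoin := Rand F k d
  dealerCoinLaw := uniformLaw (Rand F k d)
  dealerCoinLaw_mem :=
    haveI : Nonempty (Rand F k d) := ⟨(0, ⟨0, Matrix.isSymm_zero⟩, 0)⟩
    uniformLaw_mem _
  Coin := fun _ => Unit
  coinLaw := fun _ => uniformLaw Unit
  coinLaw_mem := fun _ => uniformLaw_mem Unit
  dealerSend := directDealerSend x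
  send := fun _ _ _ _ => none

end Sneak

end

/-! Lower bounds. Fix a set `J` of k - 1 participants other than ℓ, and let V be their joint view. V
is independent of the secret S, whereas V together with the data received by ℓ determines S.
Whatever J sends to ℓ is a function of V. So if T contains all edges into ℓ that do not come from
`J`, then H(S) + H(V) = H(S, V) ≤ H(V) + ∑_{u ∈ T} H(X_u), and hence H(S) ≤ ∑_{u ∈ T} H(X_u)
(`entropy_le_sum_of_subset`). If ℓ is not adjacent to the dealer, `J` can be any k - 1
in-neighbours, and averaging over all T of size deg(ℓ) - k + 1 gives the bound. If deg(ℓ) < k, `J`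
can cover all in-neighbours and T is empty, so H(S) ≤ 0. Taking T to be all incoming edges gives
Γ(ℓ) ≥ 1.

Attainment. G' keeps the edges at ℓ and otherwise only joins the dealer to the remaining
participants. Since M is symmetric, the symbol ψ_jᵀ M ψ_i sent from j to i is a linear functional of
the row ψ_iᵀ M. Therefore d symbols give back the row of i, and everything i ever receives is a
function of that row (`sent_eq_of_row_eq`). Shares for k points determine the secret by polynomial
interpolation (`secret_eq_of_share_eq`). Fewer than k rows reveal nothing: every secret can be
completed to a matrix M whose rows at these points vanish (`exists_row_eq_zero`), and adding such a
matrix changes the secret but not the rows. Similarly, shifting the secret alone acts transitively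
on each downloaded symbol or share, which is therefore uniform. -/

noncomputable section

/-! ### Entropy on finite probability spaces -/

section Entropy

variable {Ω α β : Type*} [Fintype Ω] [Fintype α] [Fintype β] {p : Ω → ℝ}

theorem finProb_nonneg (hp : ∀ ω, 0 ≤ p ω) (E : Ω → Prop) : 0 ≤ finProb p E :=
  Finset.sum_nonneg fun ω _ => by split_ifs <;> simp [hp]

theorem finProb_mono (hp : ∀ ω, 0 ≤ p ω) {E E' : Ω → Prop} (h : ∀ ω, E ω → E' ω) :
    finProb p E ≤ finProb p E' :=
  Finset.sum_le_sum fun ω _ => by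
    by_cases h1 : E ω
    · simp [h1, h ω h1]
    · simp only [h1, if_false]; split_ifs <;> simp [hp]

theorem finProb_congr {E E' : Ω → Prop} (h : ∀ ω, p ω ≠ 0 → (E ω ↔ E' ω)) :
    finProb p E = finProb p E' :=
  Finset.sum_congr rfl fun ω _ => by
    by_cases h1 : p ω = 0
    · simp [h1]
    · by_cases h2 : E ω
      · simp [h2, (h ω h1).1 h2]
      · simp [h2, mt (h ω h1).2 h2]

theorem finProb_eq_sum (X : Ω → α) (E : Ω → Prop) :
    finProb p E = ∑ x, finProb p (fun ω => E ω ∧ X ω = x) := by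
  classical
  unfold finProb
  rw [Finset.sum_comm]
  refine Finset.sum_congr rfl fun ω _ => ?_
  by_cases h : E ω <;> simp [h]

theorem sum_finProb (X : Ω → α) : ∑ x, finProb p (fun ω => X ω = x) = ∑ ω, p ω := by
  have h := finProb_eq_sum (p := p) X (fun _ => True)
  simp only [true_and] at h
  rw [← h]
  simp [finProb]

theorem shannonEntropy_congr {X Y : Ω → α} (h : ∀ ω, p ω ≠ 0 → X ω = Y ω) :
    shannonEntropy p X = shannonEntropy p Y := by
  refine Finset.sum_congr rfl fun x _ => congrArg _ (finProb_congr fun ω hω => ?_)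
  rw [h ω hω]

theorem shannonEntropy_const (hp : ∑ ω, p ω = 1) (a : α) :
    shannonEntropy p (fun _ => a) = 0 := by
  refine Finset.sum_eq_zero fun x _ => ?_
  by_cases h : a = x <;> simp [finProb, h, hp]

theorem Real.negMulLog_sum_le {ι : Type*} (s : Finset ι) (a : ι → ℝ) (ha : ∀ i ∈ s, 0 ≤ a i) :
    Real.negMulLog (∑ i ∈ s, a i) ≤ ∑ i ∈ s, Real.negMulLog (a i) := by
  rw [Real.negMulLog, neg_mul, Finset.sum_mul, ← Finset.sum_neg_distrib]
  refine Finset.sum_le_sum fun i hi => ?_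
  rcases (ha i hi).eq_or_lt with h | h
  · simp [← h]
  · have h1 : a i ≤ ∑ j ∈ s, a j := Finset.single_le_sum ha hi
    have h2 := Real.log_le_log h h1
    rw [Real.negMulLog, neg_mul]
    nlinarith

theorem shannonEntropy_comp_le (hp : ∀ ω, 0 ≤ p ω) (X : Ω → α) (f : α → β) :
    shannonEntropy p (fun ω => f (X ω)) ≤ shannonEntropy p X := by
  classical
  have h1 : ∀ y, finProb p (fun ω => f (X ω) = y) =
      ∑ x with f x = y, finProb p (fun ω => X ω = x) := fun y => by
    rw [finProb_eq_sum X, Finset.sum_filter]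
    refine Finset.sum_congr rfl fun x _ => ?_
    split_ifs with h
    · exact finProb_congr fun ω _ => ⟨fun h => h.2, fun h' => ⟨by rw [h', h], h'⟩⟩
    · refine Finset.sum_eq_zero fun ω _ => if_neg ?_
      rintro ⟨h2, h3⟩
      exact h (h3 ▸ h2)
  unfold shannonEntropy
  rw [← Finset.sum_fiberwise (s := Finset.univ) (g := f)]
  refine Finset.sum_le_sum fun y _ => ?_
  rw [h1]
  exact Real.negMulLog_sum_le _ _ fun _ _ => finProb_nonneg hp _

theorem shannonEntropy_comp_injective (hp : ∀ ω, 0 ≤ p ω) (X : Ω → α) {f : α → β}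
    (hf : Function.Injective f) : shannonEntropy p (fun ω => f (X ω)) = shannonEntropy p X := by
  rcases isEmpty_or_nonempty α with h | h
  · have : IsEmpty Ω := X.isEmpty
    simp [shannonEntropy, finProb]
  refine le_antisymm (shannonEntropy_comp_le hp X f) ?_
  refine le_of_eq_of_le ?_ (shannonEntropy_comp_le hp (fun ω => f (X ω)) (Function.invFun f))
  exact congrArg _ (funext fun ω => (Function.leftInverse_invFun hf (X ω)).symm)

theorem shannonEntropy_le_of_determines (hp : p ∈ stdSimplex ℝ Ω) (X : Ω → α) (Z : Ω → β)
    (h : ∀ ω ω', 0 < p ω → 0 < p ω' → X ω = X ω' → Z ω = Z ω') :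
    shannonEntropy p Z ≤ shannonEntropy p X := by
  classical
  obtain ⟨ω₀⟩ : Nonempty Ω := by
    by_contra h
    rw [not_nonempty_iff] at h
    simpa using hp.2
  let g : α → β := fun x =>
    if h : ∃ ω, 0 < p ω ∧ X ω = x then Z h.choose else Z ω₀
  refine le_of_eq_of_le (shannonEntropy_congr fun ω hω => ?_) (shannonEntropy_comp_le hp.1 X g)
  have hpos := (hp.1 ω).lt_of_ne' hω
  have hex : ∃ ω', 0 < p ω' ∧ X ω' = X ω := ⟨ω, hpos, rfl⟩
  simp only [g, dif_pos hex]
  exact h _ _ hpos hex.choose_spec.1 hex.choose_spec.2.symm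

omit [Fintype α] in
theorem finProb_fst (X : Ω → α) (Y : Ω → β) (x : α) :
    ∑ y, finProb p (fun ω => (X ω, Y ω) = (x, y)) = finProb p (fun ω => X ω = x) := by
  rw [finProb_eq_sum Y]
  simp only [Prod.mk.injEq]

omit [Fintype β] in
theorem finProb_snd (X : Ω → α) (Y : Ω → β) (y : β) :
    ∑ x, finProb p (fun ω => (X ω, Y ω) = (x, y)) = finProb p (fun ω => Y ω = y) := by
  rw [finProb_eq_sum X]
  simp only [Prod.mk.injEq, and_comm]

theorem shannonEntropy_prod_le (hp : p ∈ stdSimplex ℝ Ω) (X : Ω → α) (Y : Ω → β) :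
    shannonEntropy p (fun ω => (X ω, Y ω)) ≤ shannonEntropy p X + shannonEntropy p Y := by
  set a : α → ℝ := fun x => finProb p (fun ω => X ω = x) with ha
  set b : β → ℝ := fun y => finProb p (fun ω => Y ω = y) with hb
  set c : α → β → ℝ := fun x y => finProb p (fun ω => (X ω, Y ω) = (x, y)) with hc
  have hca : ∀ x, ∑ y, c x y = a x := finProb_fst X Y
  have hcb : ∀ y, ∑ x, c x y = b y := finProb_snd X Y
  have sa : ∑ x, a x = 1 := (sum_finProb X).trans hp.2
  have sb : ∑ y, b y = 1 := (sum_finProb Y).trans hp.2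
  -- This is log t ≤ t - 1 at t = a b / c. The correction terms a b - c sum to 1 - 1 = 0.
  have key : ∀ x y, Real.negMulLog (c x y) ≤
      -(c x y * Real.log (a x)) - c x y * Real.log (b y) + (a x * b y - c x y) := fun x y => by
    have c0 : 0 ≤ c x y := finProb_nonneg hp.1 _
    have c1 : c x y ≤ a x := finProb_mono hp.1 (by simp +contextual)
    have c2 : c x y ≤ b y := finProb_mono hp.1 (by simp +contextual)
    rcases c0.eq_or_lt with h | h
    · rw [← h] at c1 c2 ⊢
      simpa using mul_nonneg c1 c2
    · have a0 := h.trans_le c1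
      have b0 := h.trans_le c2
      have h1 := Real.log_le_sub_one_of_pos (div_pos (mul_pos a0 b0) h)
      rw [Real.log_div (mul_pos a0 b0).ne' h.ne', Real.log_mul a0.ne' b0.ne'] at h1
      have h2 := mul_le_mul_of_nonneg_left h1 c0
      have h3 : c x y * (a x * b y / c x y - 1) = a x * b y - c x y := by field_simp
      rw [h3] at h2
      rw [Real.negMulLog]
      linarith
  calc shannonEntropy p (fun ω => (X ω, Y ω)) = ∑ x, ∑ y, Real.negMulLog (c x y) :=
        Fintype.sum_prod_type _
    _ ≤ ∑ x, ∑ y, (-(c x y * Real.log (a x)) - c x y * Real.log (b y) + (a x * b y - c x y)) :=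
        Finset.sum_le_sum fun x _ => Finset.sum_le_sum fun y _ => key x y
    _ = ∑ x, Real.negMulLog (a x) + ∑ y, Real.negMulLog (b y) := by
        simp only [Finset.sum_add_distrib, Finset.sum_sub_distrib, Finset.sum_neg_distrib]
        rw [Finset.sum_comm (f := fun x y => c x y * Real.log (b y))]
        simp only [← Finset.sum_mul, ← Finset.mul_sum, hca, hcb, sa, sb, Real.negMulLog, neg_mul,
          Finset.sum_neg_distrib]
        ring

theorem shannonEntropy_prod_of_indep (hp : p ∈ stdSimplex ℝ Ω) (X : Ω → α) (Y : Ω → β)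
    (h : ∀ x y, finProb p (fun ω => X ω = x ∧ Y ω = y) =
      finProb p (fun ω => X ω = x) * finProb p (fun ω => Y ω = y)) :
    shannonEntropy p (fun ω => (X ω, Y ω)) = shannonEntropy p X + shannonEntropy p Y := by
  have sa := (sum_finProb (p := p) X).trans hp.2
  have sb := (sum_finProb (p := p) Y).trans hp.2
  unfold shannonEntropy
  rw [Fintype.sum_prod_type]
  simp only [Prod.mk.injEq, h, Real.negMulLog_mul, Finset.sum_add_distrib]
  simp only [← Finset.sum_mul, ← Finset.mul_sum, sa, sb, one_mul]

/-- Masking with `none` outside `T` keeps the type of the subfamily fixed, so that induction on `T`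
is possible. -/
theorem shannonEntropy_family_le {ι : Type*} [Fintype ι] [DecidableEq ι] (hp : p ∈ stdSimplex ℝ Ω)
    (X : ι → Ω → α) (T : Finset ι) :
    shannonEntropy p (fun ω i => if i ∈ T then some (X i ω) else none) ≤
      ∑ i ∈ T, shannonEntropy p (X i) := by
  induction T using Finset.induction_on with
  | empty => simpa using (shannonEntropy_const hp.2 (fun _ : ι => (none : Option α))).le
  | insert j T hj ih =>
    rw [Finset.sum_insert hj]
    refine le_trans ?_ ((shannonEntropy_prod_le hp (X j) _).trans (by gcongr))
    refine shannonEntropy_le_of_determines hp _ _ fun ω ω' _ _ h => funext fun i => ?_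
    rw [Prod.mk.injEq] at h
    rcases eq_or_ne i j with rfl | hi
    · simp [h.1]
    · simpa [hi] using congrFun h.2 i

theorem shannonEntropy_of_uniform [Nonempty α] (X : Ω → α)
    (h : ∀ x, finProb p (fun ω => X ω = x) = 1 / (Fintype.card α : ℝ)) :
    shannonEntropy p X = Real.log (Fintype.card α) := by
  have h0 : (Fintype.card α : ℝ) ≠ 0 := by exact_mod_cast Fintype.card_ne_zero
  simp only [shannonEntropy, h, Finset.sum_const, Finset.card_univ, nsmul_eq_mul, Real.negMulLog,
    one_div, Real.log_inv]
  field_simp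

theorem shannonEntropy_uniformLaw [Nonempty α] :
    shannonEntropy (uniformLaw α) id = Real.log (Fintype.card α) :=
  shannonEntropy_of_uniform _ fun x => by
    rw [finProb, Finset.sum_eq_single x] <;> simp +contextual [uniformLaw]

/-- A random variable whose values are permuted transitively by symmetries of the probability
space is uniform. -/
theorem shannonEntropy_of_transitive [Nonempty α] (hp : ∑ ω, p ω = 1) (X : Ω → α)
    (h : ∀ x y, ∃ e : Ω ≃ Ω, (∀ ω, p (e ω) = p ω) ∧ ∀ ω, X ω = x ↔ X (e ω) = y) :
    shannonEntropy p X = Real.log (Fintype.card α) := by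
  have h1 : ∀ x y, finProb p (fun ω => X ω = x) = finProb p (fun ω => X ω = y) := fun x y => by
    obtain ⟨e, he, hX⟩ := h x y
    refine Fintype.sum_equiv e _ _ fun ω => ?_
    by_cases h : X ω = x
    · simp [h, (hX ω).1 h, he]
    · simp [h, mt (hX ω).2 h]
  refine shannonEntropy_of_uniform X fun x => ?_
  have h2 := (sum_finProb (p := p) X).trans hp
  simp only [h1 _ x, Finset.sum_const, Finset.card_univ, nsmul_eq_mul] at h2
  rw [eq_div_iff (by exact_mod_cast Fintype.card_ne_zero), mul_comm, h2]

/-- If the sum of `h` over each `m`-element subset of `s` is at least `c`, then the average of `h`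
over `s` is at least `c / m`. -/
theorem Finset.card_mul_le_mul_sum_of_forall_card_eq {ι : Type*} (h : ι → ℝ) {m : ℕ} {c : ℝ}
    (s : Finset ι) (hm : 1 ≤ m) (hs : m ≤ s.card)
    (H : ∀ t ⊆ s, t.card = m → c ≤ ∑ i ∈ t, h i) : s.card * c ≤ m * ∑ i ∈ s, h i := by
  classical
  induction hN : s.card generalizing s with
  | zero => omega
  | succ N ih =>
    rcases hs.eq_or_lt with h1 | h1
    · rw [← hN, ← h1]
      exact mul_le_mul_of_nonneg_left (H s subset_rfl h1.symm) (by positivity)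
    · have h2 : ∀ i ∈ s, N * c ≤ m * (∑ j ∈ s, h j - h i) := fun i hi => by
        have hc : (s.erase i).card = N := by rw [Finset.card_erase_of_mem hi, hN]; rfl
        have := ih (s.erase i) (by omega)
          (fun t ht => H t (ht.trans (Finset.erase_subset _ _))) hc
        rwa [Finset.sum_erase_eq_sub hi] at this
      -- In the sum over `i` each `h j` is counted `N` times, as it is missing only for `i = j`. The
      -- common factor `N` is then cancelled.
      have h3 := Finset.sum_le_sum h2
      rw [Finset.sum_const, ← Finset.mul_sum, Finset.sum_sub_distrib, Finset.sum_const, hN,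
        nsmul_eq_mul, nsmul_eq_mul] at h3
      have hN0 : 0 < (N : ℝ) := by
        have : 0 < N := by omega
        exact_mod_cast this
      push_cast at h3 ⊢
      refine le_of_mul_le_mul_left ?_ hN0
      linarith

end Entropy

/-! ### Lower bounds -/

namespace Protocol

variable {n : ℕ} {G : Digraph (Node n)} {A : Type}

theorem prob_mem [Fintype A] (P : Protocol G A) {μ : A → ℝ} (hμ : μ ∈ stdSimplex ℝ A) :
    P.prob μ ∈ stdSimplex ℝ P.Outcome := by
  classical
  refine ⟨fun ω => mul_nonneg (hμ.1 _) (mul_nonneg (P.dealerCoinLaw_mem.1 _)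
    (Finset.prod_nonneg fun i _ => (P.coinLaw_mem i).1 _)), ?_⟩
  have h : ∑ c : (∀ i, P.Coin i), ∏ i, P.coinLaw i (c i) = 1 := by
    rw [← Fintype.prod_sum]
    exact Finset.prod_eq_one fun i _ => (P.coinLaw_mem i).2
  simp only [Fintype.sum_prod_type, prob, ← Finset.mul_sum, h, mul_one, P.dealerCoinLaw_mem.2]
  exact hμ.2

theorem finProb_secret [Fintype A] (P : Protocol G A) {μ : A → ℝ} (s : A) :
    finProb (P.prob μ) (fun ω => ω.1 = s) = μ s := by
  classical
  have h : ∑ c : (∀ i, P.Coin i), ∏ i, P.coinLaw i (c i) = 1 := by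
    rw [← Fintype.prod_sum]
    exact Finset.prod_eq_one fun i _ => (P.coinLaw_mem i).2
  have h2 : ∀ a, (∑ x : P.DealerCoin × (∀ i, P.Coin i), if a = s then P.prob μ (a, x) else 0) =
      if a = s then μ a else 0 := fun a => by
    split_ifs
    · simp only [Fintype.sum_prod_type, prob, ← Finset.mul_sum, h, mul_one, P.dealerCoinLaw_mem.2]
    · simp
  unfold finProb
  rw [Fintype.sum_prod_type]
  simp only [h2]
  simp

theorem hist_eq_of_received_eq (P : Protocol G A) {ω ω' : P.Outcome} {i : Fin n}
    (h : P.received ω i = P.received ω' i) :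
    ∀ t ≤ P.rounds, P.hist ω t (some i) = P.hist ω' t (some i)
  | 0, _ => rfl
  | t + 1, ht => by
    simp only [hist]
    rw [hist_eq_of_received_eq P h t (by omega)]
    congr 1
    funext u
    exact congrFun (congrFun h u) ⟨t, by omega⟩

/-- A participant's messages depend only on its coins and its history, and the history is contained
in the received data. -/
theorem transcript_eq_of_view_eq (P : Protocol G A) {ω ω' : P.Outcome} {i : Fin n}
    (h : P.view ω i = P.view ω' i) {v : Node n} (hv : G.Adj (some i) v) :
    P.transcript ω v ⟨some i, hv⟩ = P.transcript ω' v ⟨some i, hv⟩ := by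
  rw [view, view, Prod.mk.injEq] at h
  funext t
  simp only [transcript, sendAt, h.1, hist_eq_of_received_eq P h.2 t t.2.le]

variable [Fintype A]

-- The core of all lower bounds: the view of `J` is independent of the secret, and the edges outside
-- `T` add nothing to that view. The hypothesis `hT` says that they all start in `J`.
open scoped Classical in
theorem entropy_le_sum_of_subset (P : Protocol G A) {μ : A → ℝ} (hμ : μ ∈ stdSimplex ℝ A)
    {k : ℕ} (hP : P.IsSecretSharing μ k) {ℓ : Fin n} {J : Finset (Fin n)} (hJ : J.card + 1 = k)
    (hℓ : ℓ ∉ J) (T : Finset (InNbr G (some ℓ))) (hT : ∀ u ∉ T, ∃ j ∈ J, u.1 = some j) :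
    shannonEntropy μ id ≤
      ∑ u ∈ T, shannonEntropy (P.prob μ) (fun ω => P.transcript ω (some ℓ) u) := by
  have hp := P.prob_mem hμ
  let V : P.Outcome → (∀ i : J, P.Coin i.1 × (InNbr G (some i.1) → Fin P.rounds → P.Msg)) :=
    fun ω i => P.view ω i.1
  let Y : P.Outcome → InNbr G (some ℓ) → Option (Fin P.rounds → P.Msg) := fun ω u =>
    if u ∈ T then some (P.transcript ω (some ℓ) u) else none
  have h1 := shannonEntropy_prod_of_indep hp (fun ω : P.Outcome => ω.1) V
    (hP.secrecy J (by omega))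
  have h2 : shannonEntropy (P.prob μ) (fun ω : P.Outcome => ω.1) = shannonEntropy μ id := by
    simp only [shannonEntropy, finProb_secret]
    simp [finProb]
  have h3 := shannonEntropy_family_le hp (fun u ω => P.transcript ω (some ℓ) u) T
  have h4 := shannonEntropy_prod_le hp V Y
  -- Recovery for the k participants `insert ℓ J`: the data of `ℓ` is read from `Y` on `T` and
  -- recomputed from `V` elsewhere.
  have h5 : shannonEntropy (P.prob μ) (fun ω : P.Outcome => (ω.1, V ω)) ≤
      shannonEntropy (P.prob μ) (fun ω => (V ω, Y ω)) := by
    refine shannonEntropy_le_of_determines hp _ _ fun ω ω' hω hω' h => ?_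
    rw [Prod.mk.injEq] at h
    obtain ⟨hV, hY⟩ := h
    obtain ⟨decode, hd⟩ := hP.recovery (insert ℓ J) (by rw [Finset.card_insert_of_notMem hℓ, hJ])
    refine Prod.ext ?_ hV
    change ω.1 = ω'.1
    rw [← hd ω hω, ← hd ω' hω']
    congr 1
    funext i
    obtain ⟨i, hi⟩ := i
    rcases Finset.mem_insert.1 hi with rfl | hi
    · funext u
      by_cases hu : u ∈ T
      · have hYu := congrFun hY u
        simp only [Y, hu, if_true, Option.some.injEq] at hYu
        exact hYu
      · obtain ⟨j, hj, huj⟩ := hT u hu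
        obtain ⟨u, hadj⟩ := u
        subst huj
        exact transcript_eq_of_view_eq P (congrFun hV ⟨j, hj⟩) hadj
    · exact congrArg Prod.snd (congrFun hV ⟨i, hi⟩)
  linarith

open scoped Classical in
theorem one_le_download (P : Protocol G A) {μ : A → ℝ} (hμ : μ ∈ stdSimplex ℝ A)
    (h0 : 0 < shannonEntropy μ id) {k : ℕ} (hk : 1 < k) (hkn : k ≤ n)
    (hP : P.IsSecretSharing μ k) (ℓ : Fin n) : 1 ≤ P.download μ ℓ := by
  obtain ⟨J, hJ, hc⟩ := Finset.exists_subset_card_eq (s := Finset.univ.erase ℓ) (n := k - 1)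
    (by rw [Finset.card_erase_of_mem (Finset.mem_univ _), Finset.card_fin]; omega)
  rw [download, one_le_div h0]
  exact P.entropy_le_sum_of_subset hμ hP (J := J) (by omega)
    (fun h => (Finset.mem_erase.1 (hJ h)).1 rfl) Finset.univ (by simp)

theorem inDeg_eq_card {ℓ : Fin n} [Fintype (InNbr G (some ℓ))] :
    inDeg G ℓ = Fintype.card (InNbr G (some ℓ)) := by
  rw [inDeg, ← Nat.card_coe_set_eq, ← Nat.card_eq_fintype_card]
  rfl

/-- A set `U` of in-neighbours of a participant that is not adjacent to the dealer consists of
participants. -/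
theorem exists_participants {ℓ : Fin n} (hG : ∀ v, ¬ G.Adj v v) (hD : ¬ G.Adj none (some ℓ))
    (U : Finset (InNbr G (some ℓ))) :
    ∃ J : Finset (Fin n), J.card = U.card ∧ ℓ ∉ J ∧ ∀ u ∈ U, ∃ j ∈ J, u.1 = some j := by
  classical
  have h : ∀ u : InNbr G (some ℓ), ∃ j : Fin n, u.1 = some j := by
    rintro ⟨_ | j, hj⟩
    · exact absurd hj hD
    · exact ⟨j, rfl⟩
  choose f hf using h
  refine ⟨U.image f, Finset.card_image_of_injective _ fun u v huv => ?_, fun h => ?_,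
    fun u hu => ⟨f u, Finset.mem_image_of_mem _ hu, hf u⟩⟩
  · exact Subtype.ext (by rw [hf, hf, huv])
  · obtain ⟨u, -, hu⟩ := Finset.mem_image.1 h
    exact hG (some ℓ) (by have := u.2; rwa [hf, hu] at this)

open scoped Classical in
theorem le_download_of_not_adj (P : Protocol G A) {μ : A → ℝ} (hμ : μ ∈ stdSimplex ℝ A)
    (h0 : 0 < shannonEntropy μ id) {k : ℕ} (hk : 1 < k) (hG : ∀ v, ¬ G.Adj v v)
    (hP : P.IsSecretSharing μ k) {ℓ : Fin n} (hD : ¬ G.Adj none (some ℓ)) (hd : k ≤ inDeg G ℓ) :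
    (inDeg G ℓ : ℝ) / ((inDeg G ℓ : ℝ) - k + 1) ≤ P.download μ ℓ := by
  have hcard : (Finset.univ : Finset (InNbr G (some ℓ))).card = inDeg G ℓ := inDeg_eq_card.symm
  have h := Finset.card_mul_le_mul_sum_of_forall_card_eq
    (fun u => shannonEntropy (P.prob μ) (fun ω => P.transcript ω (some ℓ) u))
    (m := inDeg G ℓ - k + 1) (c := shannonEntropy μ id) Finset.univ (by omega)
    -- The complement of `T` has k - 1 elements, which serve as `J`.
    (by omega) fun T _ hT => by
      obtain ⟨J, hJ, hℓ, hJT⟩ := exists_participants hG hD Tᶜ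
      rw [Finset.card_compl, ← Finset.card_univ, hcard] at hJ
      exact P.entropy_le_sum_of_subset hμ hP (J := J) (by omega) hℓ T
        fun u hu => hJT u (Finset.mem_compl.2 hu)
  rw [hcard] at h
  push_cast [Nat.cast_sub hd] at h
  have hd' : (k : ℝ) ≤ inDeg G ℓ := by exact_mod_cast hd
  rw [download, div_le_div_iff₀ (by linarith) h0]
  linarith

theorem not_isSecretSharing_of_inDeg_lt (P : Protocol G A) {μ : A → ℝ} (hμ : μ ∈ stdSimplex ℝ A)
    (h0 : 0 < shannonEntropy μ id) {k : ℕ} (hkn : k ≤ n) (hG : ∀ v, ¬ G.Adj v v)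
    {ℓ : Fin n} (hD : ¬ G.Adj none (some ℓ)) (hd : inDeg G ℓ < k) : ¬ P.IsSecretSharing μ k := by
  classical
  intro hP
  obtain ⟨J, hJ, hℓ, hJT⟩ := exists_participants hG hD Finset.univ
  rw [Finset.card_univ, ← inDeg_eq_card] at hJ
  -- The in-neighbours are padded to k - 1 participants, so that no edge into `ℓ` is left for `T`.
  obtain ⟨K, hJK, hK, hc⟩ := Finset.exists_subsuperset_card_eq (s := J)
    (t := Finset.univ.erase ℓ) (n := k - 1)
    (fun j hj => Finset.mem_erase.2 ⟨fun h => hℓ (h ▸ hj), Finset.mem_univ _⟩) (by omega)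
    (by rw [Finset.card_erase_of_mem (Finset.mem_univ _), Finset.card_fin]; omega)
  have := P.entropy_le_sum_of_subset hμ hP (J := K) (by omega) (fun h => (Finset.mem_erase.1 (hK h)).1 rfl) ∅
    fun u _ => by
      obtain ⟨j, hj, h⟩ := hJT u (Finset.mem_univ _)
      exact ⟨j, hJK hj, h⟩
  simp only [Finset.sum_empty] at this
  linarith

end Protocol

/-! ### The linear algebra of the SNEAK algorithm -/

open Polynomial in
/-- A linear combination of distinct powers with exponents below `m` that vanishes at `m` points
is trivial. -/
theorem eq_zero_of_sum_mul_pow_eq_zero {F ι : Type*} [Field F] [Fintype ι] {e : ι → ℕ} {m : ℕ}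
    (he : Function.Injective e) (hm : ∀ i, e i < m) {v : ι → F} (T : Finset F) (hT : m ≤ T.card)
    (hv : ∀ y ∈ T, ∑ i, v i * y ^ e i = 0) : v = 0 := by
  classical
  let p : F[X] := ∑ i, C (v i) * X ^ e i
  have hp : p.degree < m := mem_degreeLT.1 <| Submodule.sum_mem _ fun i _ =>
    mem_degreeLT.2 ((degree_C_mul_X_pow_le _ _).trans_lt (by exact_mod_cast hm i))
  have h0 : p = 0 := Polynomial.eq_zero_of_degree_lt_of_eval_finset_eq_zero T
    (hp.trans_le (by exact_mod_cast hT)) fun y hy => by simpa [p, eval_finsetSum] using hv y hy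
  funext j
  have h1 := congrArg (fun q => coeff q (e j)) h0
  simpa [p, finsetSum_coeff, coeff_C_mul, coeff_X_pow, he.eq_iff] using h1

open Polynomial in
-- Interpolation of g(y) / y by a polynomial of degree below `m`; the exponents start at 1, which is
-- why the points must be nonzero.
theorem exists_sum_pow_succ_mul_eq {F : Type*} [Field F] {m : ℕ} (T : Finset F) (hT : T.card ≤ m)
    (h0 : (0 : F) ∉ T) (g : F → F) :
    ∃ a : Fin m → F, ∀ y ∈ T, ∑ b, y ^ (b.1 + 1) * a b = g y := by
  classical
  let p : F[X] := Lagrange.interpolate T id (fun y => g y / y)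
  have hp : p.degree < m := (Lagrange.degree_interpolate_lt _ Function.injective_id.injOn).trans_le
    (by exact_mod_cast hT)
  refine ⟨fun b => p.coeff b, fun y hy => ?_⟩
  have hy0 : y ≠ 0 := fun h => h0 (h ▸ hy)
  have h1 : p.eval y = g y / y :=
    Lagrange.eval_interpolate_at_node (v := id) _ Function.injective_id.injOn hy
  have hn : p.natDegree < m := by
    by_cases h : p = 0
    · simpa [h] using (Finset.card_pos.2 ⟨y, hy⟩).trans_le hT
    · exact (natDegree_lt_iff_degree_lt h).2 hp
  have h2 : p.eval y = ∑ b : Fin m, p.coeff b * y ^ b.1 := by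
    rw [eval_eq_sum_range' hn, Finset.sum_range]
  calc ∑ b : Fin m, y ^ (b.1 + 1) * p.coeff b = y * p.eval y := by
        rw [h2, Finset.mul_sum]
        exact Finset.sum_congr rfl fun b _ => by ring
    _ = g y := by rw [h1, mul_div_cancel₀ _ hy0]

namespace Sneak

variable {F : Type} [Field F] {k d : ℕ}

def expo (k d : ℕ) : Idx k d → ℕ
  | .inl _ => 0
  | .inr (.inl a) => a.1 + 1
  | .inr (.inr c) => k + c.1

theorem enc_eq_pow (y : F) (i : Idx k d) : enc k d y i = y ^ expo k d i := by
  rcases i with _ | _ | _ <;> simp [enc, expo]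

theorem expo_injective (hk : 1 ≤ k) : Function.Injective (expo k d) := by
  rintro (_ | a | a) (_ | b | b) h <;> simp only [expo] at h
  · rfl
  · omega
  · omega
  · omega
  · have : a = b := Fin.ext (by omega)
    rw [this]
  · have := a.2; omega
  · omega
  · have := b.2; omega
  · have : a = b := Fin.ext (by omega)
    rw [this]

theorem expo_lt (hk : 1 ≤ k) (hkd : k ≤ d) (i : Idx k d) : expo k d i < d := by
  rcases i with _ | a | a <;> simp only [expo]
  · omega
  · have := a.2; omega
  · have := a.2; omega

theorem card_idx (hk : 1 ≤ k) (hkd : k ≤ d) : Fintype.card (Idx k d) = d := by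
  simp; omega

theorem eq_of_dotProduct_enc_eq (hk : 1 ≤ k) (hkd : k ≤ d) {v w : Idx k d → F} (T : Finset F)
    (hT : d ≤ T.card) (h : ∀ y ∈ T, v ⬝ᵥ enc k d y = w ⬝ᵥ enc k d y) : v = w := by
  rw [← sub_eq_zero]
  refine eq_zero_of_sum_mul_pow_eq_zero (expo_injective hk) (expo_lt hk hkd) T hT fun y hy => ?_
  have := h y hy
  rw [← sub_eq_zero, ← sub_dotProduct] at this
  simpa only [dotProduct, enc_eq_pow] using this

theorem isUnit_encMatrix (hk : 1 ≤ k) (hkd : k ≤ d) {y : Idx k d → F}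
    (hy : Function.Injective y) : IsUnit (Matrix.of fun r => enc k d (y r)) := by
  classical
  rw [← Matrix.mulVec_injective_iff_isUnit]
  intro v w h
  refine eq_of_dotProduct_enc_eq hk hkd (Finset.univ.image y)
    (by rw [Finset.card_image_of_injective _ hy, Finset.card_univ, card_idx hk hkd]) fun z hz => ?_
  obtain ⟨r, -, rfl⟩ := Finset.mem_image.1 hz
  have := congrFun h r
  rw [dotProduct_comm v, dotProduct_comm w]
  exact this

theorem mat_comm (s : Secret F k d) (r : Rand F k d) (i j : Idx k d) :
    mat s r i j = mat s r j i := by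
  rcases i with _ | _ | _ <;> rcases j with _ | _ | _ <;> simp only [mat]
  exact r.2.1.2.apply _ _

/-- The reason for making M symmetric: a symbol computed from the sender's row is also a functional
of the receiver's row. -/
theorem row_dotProduct_comm (s : Secret F k d) (r : Rand F k d) (y z : F) :
    row s r y ⬝ᵥ enc k d z = row s r z ⬝ᵥ enc k d y := by
  have h : (mat s r).transpose = mat s r := Matrix.ext fun i j => mat_comm s r j i
  rw [row, ← Matrix.dotProduct_mulVec, row, dotProduct_comm, ← Matrix.vecMul_transpose, h]

theorem row_zero (s : Secret F k d) (r : Rand F k d) (y : F) :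
    row s r y (.inl ()) = s (Fin.last (d - k)) + (∑ a : Fin (k - 1), y ^ (a.1 + 1) * r.1 a +
      ∑ c : Fin (d - k), y ^ (k + c.1) * s c.castSucc) := by
  simp [row, Matrix.vecMul, dotProduct, Fintype.sum_sum_type, enc, mat]

theorem row_mid (s : Secret F k d) (r : Rand F k d) (y : F) (b : Fin (k - 1)) :
    row s r y (.inr (.inl b)) = r.1 b + (∑ a : Fin (k - 1), y ^ (a.1 + 1) * r.2.1.1 a b +
      ∑ c : Fin (d - k), y ^ (k + c.1) * r.2.2 c b) := by
  simp [row, Matrix.vecMul, dotProduct, Fintype.sum_sum_type, enc, mat]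

theorem row_last (s : Secret F k d) (r : Rand F k d) (y : F) (c : Fin (d - k)) :
    row s r y (.inr (.inr c)) =
      s c.castSucc + ∑ a : Fin (k - 1), y ^ (a.1 + 1) * r.2.2 c a := by
  simp [row, Matrix.vecMul, dotProduct, Fintype.sum_sum_type, enc, mat]

/-- The shares for `k` points determine the secret. -/
theorem secret_eq_of_share_eq (hk : 1 ≤ k) {s s' : Secret F k d} {r r' : Rand F k d}
    (T : Finset F) (hT : k ≤ T.card) (h : ∀ y ∈ T, share s r y = share s' r' y) : s = s' := by
  -- Each of the last columns of ψᵀ M is a polynomial in the point with exponents 0, …, k - 1, and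
  -- its constant term is a symbol of the secret.
  let e : Unit ⊕ Fin (k - 1) → ℕ := Sum.elim 0 (fun a => a.1 + 1)
  have he : Function.Injective e := by
    rintro (_ | a) (_ | b) h <;> simp [e] at h ⊢
    exact Fin.ext h
  have hm : ∀ i, e i < k := by
    rintro (_ | a)
    · exact hk
    · have := a.2; simp only [e, Sum.elim_inr]; omega
  have h1 : ∀ c : Fin (d - k), s c.castSucc = s' c.castSucc := fun c => by
    have := eq_zero_of_sum_mul_pow_eq_zero he hm
      (v := Sum.elim (fun _ => s c.castSucc - s' c.castSucc) (fun a => r.2.2 c a - r'.2.2 c a))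
      T hT fun y hy => by
        have := congrFun (h y hy) (.inr c)
        simp only [share, row_last] at this
        rw [← sub_eq_zero] at this
        rw [← this]
        simp only [Fintype.sum_sum_type, Sum.elim_inl, Sum.elim_inr, e, Pi.zero_apply, pow_zero,
          mul_one, Finset.univ_unique, Finset.sum_singleton, sub_mul, Finset.sum_sub_distrib,
          mul_comm (y ^ _)]
        ring
    exact sub_eq_zero.1 (congrFun this (.inl ()))
  -- The first column also has the terms y ^ (k + c) with coefficients S_B; these cancel by `h1`,
  -- leaving degree below k.
  have h2 : s (Fin.last _) = s' (Fin.last _) := by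
    have := eq_zero_of_sum_mul_pow_eq_zero he hm
      (v := Sum.elim (fun _ => s (Fin.last _) - s' (Fin.last _)) (fun a => r.1 a - r'.1 a))
      T hT fun y hy => by
        have := congrFun (h y hy) (.inl ())
        simp only [share, row_zero, h1] at this
        rw [← sub_eq_zero] at this
        rw [← this]
        simp only [Fintype.sum_sum_type, Sum.elim_inl, Sum.elim_inr, e, Pi.zero_apply, pow_zero,
          mul_one, Finset.univ_unique, Finset.sum_singleton, sub_mul, Finset.sum_sub_distrib,
          mul_comm (y ^ _)]
        ring
    exact sub_eq_zero.1 (congrFun this (.inl ()))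
  funext i
  exact Fin.lastCases h2 h1 i

/-- Fewer than `k` rows can be explained by every secret. -/
theorem exists_row_eq_zero (s : Secret F k d) (T : Finset F) (hT : T.card < k)
    (h0 : (0 : F) ∉ T) : ∃ r : Rand F k d, ∀ y ∈ T, row s r y = 0 := by
  obtain ⟨a, ha⟩ := exists_sum_pow_succ_mul_eq (m := k - 1) T (by omega) h0 (fun _ => -1)
  obtain ⟨b, hb⟩ := exists_sum_pow_succ_mul_eq (m := k - 1) T (by omega) h0
    (fun y => -∑ c : Fin (d - k), y ^ (k + c.1) * s c.castSucc)
  set σ := s (Fin.last (d - k)) with hσ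
  -- With p = (1, a, 0) and q = (0, b, S_B), this is the matrix M = σ p pᵀ + p qᵀ + q pᵀ. It has the
  -- prescribed secret and zero block, and `ha`, `hb` say that ψ is orthogonal to p and to q at the
  -- points of `T`.
  refine ⟨(fun i => σ * a i + b i,
    ⟨Matrix.of fun i j => σ * (a i * a j) + a i * b j + b i * a j,
      Matrix.IsSymm.ext fun i j => by simp only [Matrix.of_apply]; ring⟩,
    Matrix.of fun c i => s c.castSucc * a i), fun y hy => ?_⟩
  have ha := ha y hy
  have hb := hb y hy
  funext i
  rcases i with _ | j | c
  · have h1 : ∑ i : Fin (k - 1), y ^ (i.1 + 1) * (σ * a i + b i) =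
        σ * (∑ i : Fin (k - 1), y ^ (i.1 + 1) * a i) + ∑ i : Fin (k - 1), y ^ (i.1 + 1) * b i := by
      rw [Finset.mul_sum, ← Finset.sum_add_distrib]
      exact Finset.sum_congr rfl fun i _ => by ring
    rw [row_zero, h1, ha, hb, ← hσ, Pi.zero_apply]
    ring
  · have h1 : ∑ i : Fin (k - 1), y ^ (i.1 + 1) * (σ * (a i * a j) + a i * b j + b i * a j) =
        (σ * a j + b j) * (∑ i : Fin (k - 1), y ^ (i.1 + 1) * a i) +
          a j * ∑ i : Fin (k - 1), y ^ (i.1 + 1) * b i := by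
      rw [Finset.mul_sum, Finset.mul_sum, ← Finset.sum_add_distrib]
      exact Finset.sum_congr rfl fun i _ => by ring
    have h2 : ∑ c : Fin (d - k), y ^ (k + c.1) * (s c.castSucc * a j) =
        a j * ∑ c : Fin (d - k), y ^ (k + c.1) * s c.castSucc := by
      rw [Finset.mul_sum]
      exact Finset.sum_congr rfl fun i _ => by ring
    rw [row_mid]
    simp only [Matrix.of_apply, h1, h2, ha, hb, Pi.zero_apply]
    ring
  · have h1 : ∑ i : Fin (k - 1), y ^ (i.1 + 1) * (s c.castSucc * a i) =
        s c.castSucc * ∑ i : Fin (k - 1), y ^ (i.1 + 1) * a i := by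
      rw [Finset.mul_sum]
      exact Finset.sum_congr rfl fun i _ => by ring
    rw [row_last]
    simp only [Matrix.of_apply, h1, ha, Pi.zero_apply]
    ring

/-- Translation of the random values of the dealer. -/
def translate (r₀ : Rand F k d) : Rand F k d ≃ Rand F k d where
  toFun r := (r.1 + r₀.1, ⟨r.2.1.1 + r₀.2.1.1, r.2.1.2.add r₀.2.1.2⟩, r.2.2 + r₀.2.2)
  invFun r := (r.1 - r₀.1, ⟨r.2.1.1 - r₀.2.1.1, r.2.1.2.sub r₀.2.1.2⟩, r.2.2 - r₀.2.2)
  left_inv r := by simp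
  right_inv r := by simp

theorem row_add_translate (s s₀ : Secret F k d) (r r₀ : Rand F k d) (y : F) :
    row (s + s₀) (translate r₀ r) y = row s r y + row s₀ r₀ y := by
  have h : mat (s + s₀) (translate r₀ r) = mat s r + mat s₀ r₀ := by
    ext i j
    rcases i with _ | _ | _ <;> rcases j with _ | _ | _ <;> simp [mat, translate]
  rw [row, h, Matrix.vecMul_add, row, row]

/-- Complete `s' - s` to a matrix whose rows on `T` vanish, and add it. -/
theorem exists_translate_row_eq (s s' : Secret F k d) (T : Finset F) (hT : T.card < k)
    (h0 : (0 : F) ∉ T) :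
    ∃ e : Rand F k d ≃ Rand F k d, ∀ r, ∀ y ∈ T, row s r y = row s' (e r) y := by
  obtain ⟨r₀, h⟩ := exists_row_eq_zero (s' - s) T hT h0
  refine ⟨translate r₀, fun r y hy => ?_⟩
  have := row_add_translate s (s' - s) r r₀ y
  rw [h y hy, add_zero, add_sub_cancel] at this
  exact this.symm

instance : Zero (Rand F k d) := ⟨(0, ⟨0, Matrix.isSymm_zero⟩, 0)⟩

theorem row_add (s s₀ : Secret F k d) (r : Rand F k d) (y : F) :
    row (s + s₀) r y = row s r y + row s₀ 0 y := by
  have h : translate 0 r = r := by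
    change (r.1 + 0, (⟨r.2.1.1 + 0, _⟩ : {R : Matrix _ _ F // R.IsSymm}), r.2.2 + 0) = r
    simp
  rw [← row_add_translate, h]

theorem share_add (s s₀ : Secret F k d) (r : Rand F k d) (y : F) :
    share (s + s₀) r y = share s r y + share s₀ 0 y := by
  funext i
  rcases i with _ | c <;> simp [share, row_add]

theorem exists_share_eq (y : F) (z : Unit ⊕ Fin (d - k) → F) :
    ∃ s : Secret F k d, share s 0 y = z := by
  let s : Secret F k d := Fin.snoc (α := fun _ => F) (fun c => z (.inr c))
    (z (.inl ()) - ∑ c : Fin (d - k), y ^ (k + c.1) * z (.inr c))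
  have h1 : (0 : Rand F k d).1 = 0 := rfl
  have h2 : (0 : Rand F k d).2.2 = 0 := rfl
  refine ⟨s, funext fun i => ?_⟩
  rcases i with _ | c
  · simp [share, row_zero, h1, s]
  · simp [share, row_last, h2, s]

/-- Take M with `z` in the first corner and 0 elsewhere; encoding vectors begin with 1. -/
theorem exists_row_dotProduct_eq (y y' z : F) :
    ∃ s : Secret F k d, row s 0 y ⬝ᵥ enc k d y' = z := by
  refine ⟨Function.update 0 (Fin.last _) z, ?_⟩
  have h1 : (0 : Rand F k d).1 = 0 := rfl
  have h2 : (0 : Rand F k d).2.2 = 0 := rfl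
  have h3 : (0 : Rand F k d).2.1.1 = 0 := rfl
  simp [dotProduct, Fintype.sum_sum_type, row_zero, row_mid, row_last, h1, h2, h3, enc]

end Sneak

/-! ### Secret sharing by the SNEAK algorithm -/

namespace Protocol

variable {n : ℕ} {G : Digraph (Node n)} {A : Type} [Fintype A]

/-- Secrecy follows from symmetries of the coins of the dealer that exchange the secrets and keep
the observation. -/
theorem indep_of_equiv (P : Protocol G A) {μ : A → ℝ} (hμ : ∑ a, μ a = 1) {β : Type*}
    (V : P.Outcome → β)
    (h : ∀ s s', ∃ e : P.DealerCoin ≃ P.DealerCoin,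
      (∀ r, P.dealerCoinLaw (e r) = P.dealerCoinLaw r) ∧
        ∀ r c, V (s, r, c) = V (s', e r, c)) (s : A) (w : β) :
    finProb (P.prob μ) (fun ω => ω.1 = s ∧ V ω = w) =
      finProb (P.prob μ) (fun ω => ω.1 = s) * finProb (P.prob μ) (fun ω => V ω = w) := by
  classical
  let q : P.DealerCoin × (∀ i, P.Coin i) → ℝ := fun b =>
    P.dealerCoinLaw b.1 * ∏ i, P.coinLaw i (b.2 i)
  -- `g a` is the probability over the coins of observing `w` when the secret is `a`; the symmetries
  -- make it constant.
  let g : A → ℝ := fun a => finProb q (fun b => V (a, b) = w)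
  have hg : ∀ a a', g a = g a' := fun a a' => by
    obtain ⟨e, he, hV⟩ := h a a'
    refine Fintype.sum_equiv (e.prodCongr (Equiv.refl _)) _ _ fun b => ?_
    have h1 : V (a', e.prodCongr (Equiv.refl _) b) = V (a, b) := (hV b.1 b.2).symm
    have h2 : q (e.prodCongr (Equiv.refl _) b) = q b := by simp [q, he]
    simp only [h1, h2]
  have h1 : ∀ a (E : A → Prop),
      (∑ b, if E a ∧ V (a, b) = w then P.prob μ (a, b) else 0) = if E a then μ a * g a else 0 :=
    fun a E => by
      split_ifs with hE
      · simp only [g, finProb, Finset.mul_sum, hE, true_and]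
        refine Finset.sum_congr rfl fun b _ => ?_
        by_cases hb : V (a, b) = w <;> simp [hb, prob, q]
      · simp [hE]
  have h2 : finProb (P.prob μ) (fun ω => V ω = w) = g s := by
    have : ∀ a, (∑ b, if V (a, b) = w then P.prob μ (a, b) else 0) = μ a * g s := fun a => by
      have := h1 a (fun _ => True)
      simp only [true_and, if_true] at this
      rw [← hg a s, ← this]
    rw [finProb, Fintype.sum_prod_type]
    rw [← one_mul (g s), ← hμ, Finset.sum_mul]
    refine Finset.sum_congr rfl fun a _ => ?_
    rw [← this a]
  rw [h2, finProb_secret, finProb, Fintype.sum_prod_type, Finset.sum_eq_single s]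
  · refine Eq.trans (Finset.sum_congr rfl fun b _ => ?_) ((h1 s (fun a => a = s)).trans (if_pos rfl))
    by_cases hb : V (s, b) = w <;> simp [hb]
  · intro a _ ha
    simp [ha]
  · simp

omit [Fintype A] in
theorem exists_decode [Nonempty A] (P : Protocol G A) {K : Finset (Fin n)}
    (h : ∀ ω ω' : P.Outcome, (∀ i ∈ K, P.received ω i = P.received ω' i) → ω.1 = ω'.1) :
    ∃ decode : (∀ i : K, InNbr G (some i.1) → Fin P.rounds → P.Msg) → A,
      ∀ ω : P.Outcome, decode (fun i => P.received ω i.1) = ω.1 := by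
  classical
  let D : P.Outcome → ∀ i : K, InNbr G (some i.1) → Fin P.rounds → P.Msg :=
    fun ω i => P.received ω i.1
  refine ⟨fun w => if hw : ∃ ω, D ω = w then hw.choose.1 else Classical.arbitrary A, fun ω => ?_⟩
  have hw : ∃ ω', D ω' = D ω := ⟨ω, rfl⟩
  refine (dif_pos hw).trans (h _ _ fun i hi => ?_)
  exact congrFun hw.choose_spec ⟨i, hi⟩

end Protocol

namespace Sneak

variable {F : Type} [Field F] [Fintype F] {n k d : ℕ} {G : Digraph (Node n)} {x : Fin n → F}

/-- Outcomes of both protocols. -/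
abbrev Out (F : Type) (n k d : ℕ) : Type := Secret F k d × Rand F k d × (Fin n → Unit)

def rowAt (x : Fin n → F) (ω : Out F n k d) (i : Fin n) : Idx k d → F := row ω.1 ω.2.1 (x i)

/-- The symbol passed from `j` to `i`. -/
def symbolAt (x : Fin n → F) (ω : Out F n k d) (j i : Fin n) : F :=
  rowAt x ω j ⬝ᵥ enc k d (x i)

omit [Fintype F] in
theorem symbolAt_comm (ω : Out F n k d) (j i : Fin n) :
    symbolAt x ω j i = symbolAt x ω i j := row_dotProduct_comm _ _ _ _

def history (G : Digraph (Node n)) (x : Fin n → F) (ω : Out F n k d) (t : ℕ) (i : Fin n) :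
    Hist F k d G i :=
  (protocol G k d x).hist ω t (some i)

/-- The message that `u` passes to `i` in round `t`. -/
def sent (G : Digraph (Node n)) (x : Fin n → F) (ω : Out F n k d) (t : ℕ) (i : Fin n)
    (u : InNbr G (some i)) : Msg F k d :=
  (protocol G k d x).sendAt ω u.1 ((protocol G k d x).hist ω t u.1) ⟨some i, u.2⟩

theorem history_zero (ω : Out F n k d) (i : Fin n) : history G x ω 0 i = [] := rfl

theorem history_succ (ω : Out F n k d) (t : ℕ) (i : Fin n) :
    history G x ω (t + 1) i = sent G x ω t i :: history G x ω t i := rfl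

theorem sent_none (ω : Out F n k d) (t : ℕ) (i : Fin n) (h : G.Adj none (some i)) :
    sent G x ω t i ⟨none, h⟩ = if t = 0 then some (.inl (rowAt x ω i)) else none := by
  cases t <;> rfl

theorem sent_some (ω : Out F n k d) (t : ℕ) (i j : Fin n) (h : G.Adj (some j) (some i)) :
    sent G x ω t i ⟨some j, h⟩ = participantSend x j (history G x ω t j) ⟨some i, h⟩ := rfl

theorem vectorFromDealer_history (ω : Out F n k d) {i : Fin n} (h : G.Adj none (some i)) (t : ℕ) :
    vectorFromDealer (history G x ω t i) = if t = 0 then none else some (rowAt x ω i) := by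
  induction t with
  | zero => simp [vectorFromDealer, history_zero]
  | succ t ih =>
    rw [vectorFromDealer, dif_pos h] at ih ⊢
    rw [history_succ, List.findSome?_cons, sent_none]
    rcases t with _ | t
    · simp [Msg.vector?]
    · simpa [Msg.vector?] using ih

/-- The values known to the nodes are correct, and the moment when they become known does not
depend on the outcome. -/
theorem exists_known_eq (hk : 1 ≤ k) (hkd : k ≤ d) (hx : Function.Injective x) (t : ℕ) (i : Fin n)
    (h : ∀ j, ∃ b : Bool, ∀ ω : Out F n k d,
      symbolFrom (history G x ω t i) j = if b then some (symbolAt x ω j i) else none) :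
    ∃ b : Bool, ∀ ω : Out F n k d,
      known x (history G x ω t i) = if b then some (rowAt x ω i) else none := by
  classical
  by_cases hD : G.Adj none (some i)
  · refine ⟨decide (t ≠ 0), fun ω => ?_⟩
    rw [known, if_pos hD, vectorFromDealer_history ω hD]
    by_cases ht : t = 0 <;> simp [ht]
  · choose b hb using h
    refine ⟨decide (∃ f : Idx k d ↪ Fin n, ∀ r, b (f r)), fun ω => ?_⟩
    have hsome : ∀ j, (symbolFrom (history G x ω t i) j).isSome = b j := fun j => by
      rw [hb]; cases b j <;> simp
    rw [known, if_neg hD]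
    by_cases hf : ∃ f : Idx k d ↪ Fin n, ∀ r, (symbolFrom (history G x ω t i) (f r)).isSome
    · have hf' : ∃ f : Idx k d ↪ Fin n, ∀ r, b (f r) := by simpa only [hsome] using hf
      rw [dif_pos hf, if_pos (decide_eq_true hf')]
      have hunit := isUnit_encMatrix (F := F) hk hkd (y := fun r => x (hf.choose r))
        (hx.comp hf.choose.injective)
      -- By symmetry of M the received symbols are Ψ applied to the row of `i` itself, so Ψ⁻¹
      -- returns this row whichever neighbours were chosen.
      have hσ : (fun r => (symbolFrom (history G x ω t i) (hf.choose r)).getD 0) =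
          Matrix.mulVec (Matrix.of fun r => enc k d (x (hf.choose r))) (rowAt x ω i) := by
        funext r
        have hr := hf.choose_spec r
        rw [hsome] at hr
        rw [hb, if_pos hr, Option.getD_some, symbolAt_comm, symbolAt, dotProduct_comm]
        rfl
      rw [hσ, Matrix.mulVec_mulVec, Matrix.nonsing_inv_mul _
        ((Matrix.isUnit_iff_isUnit_det _).1 hunit), Matrix.one_mulVec]
    · have hf' : ¬ ∃ f : Idx k d ↪ Fin n, ∀ r, b (f r) := by simpa only [hsome] using hf
      rw [dif_neg hf, if_neg (by simpa using hf')]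

theorem exists_sent_eq {t : ℕ} {i j : Fin n} (h : G.Adj (some j) (some i)) {b₀ b₁ b₂ : Bool}
    (h₀ : ∀ ω : Out F n k d,
      known x (history G x ω t j).tail = if b₀ then some (rowAt x ω j) else none)
    (h₁ : ∀ ω : Out F n k d, known x (history G x ω t j) = if b₁ then some (rowAt x ω j) else none)
    (h₂ : ∀ ω : Out F n k d,
      symbolFrom (history G x ω t j) i = if b₂ then some (symbolAt x ω i j) else none) :
    ∃ b : Bool, ∀ ω : Out F n k d,
      sent G x ω t i ⟨some j, h⟩ = if b then some (.inr (symbolAt x ω j i)) else none := by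
  classical
  refine ⟨!b₀ && b₁ && (decide (G.Adj none (some j)) || !b₂), fun ω => ?_⟩
  rw [sent_some, participantSend, h₀, h₁, h₂]
  cases b₀ <;> cases b₁ <;> cases b₂ <;> simp [symbolAt]

/-- Each `b` is chosen before `ω`: the timing of messages carries no information. The clause on
`tail` concerns the previous round and is carried along because `participantSend` compares the two
rounds. -/
theorem symbolFrom_history_eq (hk : 1 ≤ k) (hkd : k ≤ d) (hx : Function.Injective x) (t : ℕ) :
    (∀ i j, ∃ b : Bool, ∀ ω : Out F n k d,
      symbolFrom (history G x ω t i) j = if b then some (symbolAt x ω j i) else none) ∧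
    ∀ i, ∃ b : Bool, ∀ ω : Out F n k d,
      known x (history G x ω t i).tail = if b then some (rowAt x ω i) else none := by
  induction t with
  | zero =>
    have h : ∀ i j, ∃ b : Bool, ∀ ω : Out F n k d,
        symbolFrom (history G x ω 0 i) j = if b then some (symbolAt x ω j i) else none :=
      fun i j => ⟨false, fun ω => by simp [symbolFrom, history_zero]⟩
    exact ⟨h, fun i => exists_known_eq hk hkd hx 0 i (h i)⟩
  | succ t ih =>
    refine ⟨fun i j => ?_, fun i => exists_known_eq hk hkd hx t i (ih.1 i)⟩
    by_cases hj : G.Adj (some j) (some i)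
    · obtain ⟨b₀, h₀⟩ := ih.2 j
      obtain ⟨b₁, h₁⟩ := exists_known_eq hk hkd hx t j (ih.1 j)
      obtain ⟨b₂, h₂⟩ := ih.1 j i
      obtain ⟨b, hb⟩ := exists_sent_eq hj h₀ h₁ h₂
      obtain ⟨b', hb'⟩ := ih.1 i j
      -- A symbol from this round and one from an earlier round would be equal, so it does not
      -- matter which is found.
      refine ⟨b || b', fun ω => ?_⟩
      have h := hb' ω
      rw [symbolFrom, dif_pos hj] at h ⊢
      rw [history_succ, List.findSome?_cons, hb ω, h]
      cases b <;> simp [Msg.symbol?]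
    · exact ⟨false, fun ω => by simp [symbolFrom, hj]⟩

/-- Secrecy of the relaying rests on this, on any network: relayed symbols add nothing to one's own
row. -/
theorem sent_eq_of_row_eq (hk : 1 ≤ k) (hkd : k ≤ d) (hx : Function.Injective x)
    {ω ω' : Out F n k d} {i : Fin n} (h : rowAt x ω i = rowAt x ω' i) (t : ℕ) :
    sent G x ω t i = sent G x ω' t i := by
  funext ⟨u, hu⟩
  rcases u with _ | j
  · rw [sent_none, sent_none, h]
  · have ih := symbolFrom_history_eq (G := G) hk hkd hx t
    obtain ⟨b₀, h₀⟩ := ih.2 j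
    obtain ⟨b₁, h₁⟩ := exists_known_eq hk hkd hx t j (ih.1 j)
    obtain ⟨b₂, h₂⟩ := ih.1 j i
    obtain ⟨b, hb⟩ := exists_sent_eq hu h₀ h₁ h₂
    rw [hb, hb, symbolAt_comm ω, symbolAt_comm ω', symbolAt, symbolAt, h]

/-- A neighbour of the dealer passes its symbols in the second round. -/
theorem sent_of_adj (ω : Out F n k d) (t : ℕ) {i j : Fin n} (h : G.Adj (some j) (some i))
    (hD : G.Adj none (some j)) :
    sent G x ω t i ⟨some j, h⟩ = if t = 1 then some (.inr (symbolAt x ω j i)) else none := by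
  have hknown : ∀ t, known x (history G x ω t j) = if t = 0 then none else some (rowAt x ω j) :=
    fun t => by rw [known, if_pos hD, vectorFromDealer_history ω hD]
  rw [sent_some, participantSend]
  rcases t with _ | t
  · rw [hknown]; simp
  · rw [hknown, history_succ, List.tail_cons, hknown]
    rcases t with _ | t <;> simp [hD, symbolAt]

section

variable {ℓ : Fin n} (hk : 1 < k) (hkn : k ≤ n) (hkd : k ≤ d) (hx : Function.Injective x)

omit [Fintype F] in
theorem exists_translate_rowAt_eq (hx0 : ∀ i, x i ≠ 0) {J : Finset (Fin n)} (hJ : J.card < k)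
    (s s' : Secret F k d) : ∃ e : Rand F k d ≃ Rand F k d, ∀ r (c : Fin n → Unit), ∀ j ∈ J,
      rowAt x (s, r, c) j = rowAt x (s', e r, c) j := by
  classical
  obtain ⟨e, he⟩ := exists_translate_row_eq s s' (J.image x) (Finset.card_image_le.trans_lt hJ)
    (by simp [hx0])
  exact ⟨e, fun r c j hj => he r _ (Finset.mem_image_of_mem _ hj)⟩

omit [Fintype F] in
include hk hx in
theorem secret_eq_of_shares_eq {K : Finset (Fin n)} (hK : K.card = k) {ω ω' : Out F n k d}
    (h : ∀ i ∈ K, share ω.1 ω.2.1 (x i) = share ω'.1 ω'.2.1 (x i)) : ω.1 = ω'.1 := by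
  classical
  refine secret_eq_of_share_eq hk.le (r := ω.2.1) (r' := ω'.2.1) (K.image x)
    (by rw [Finset.card_image_of_injective _ hx, hK]) fun y hy => ?_
  obtain ⟨i, hi, rfl⟩ := Finset.mem_image.1 hy
  exact h i hi

omit [Fintype F] in
theorem share_eq_of_row_eq {ω ω' : Out F n k d} {i : Fin n}
    (h : rowAt x ω i = rowAt x ω' i) : share ω.1 ω.2.1 (x i) = share ω'.1 ω'.2.1 (x i) := by
  funext c
  rcases c with _ | c
  · exact congrFun h _
  · exact congrFun h _

open scoped Classical in
include hk hkn hkd hx in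
theorem protocol_isSecretSharing (hx0 : ∀ i, x i ≠ 0) (hG : ∀ v, ¬ G.Adj v v)
    (hℓ : ¬ G.Adj none (some ℓ)) (hD : ∀ i, i ≠ ℓ → G.Adj none (some i)) (hd : inDeg G ℓ = d) :
    (protocol G k d x).IsSecretSharing (uniformLaw (Secret F k d)) k where
  recovery K hK := by
    obtain ⟨decode, h⟩ := (protocol G k d x).exists_decode (K := K)
      fun (ω ω' : Out F n k d) h => by
      refine secret_eq_of_shares_eq hk hx hK fun i hi => share_eq_of_row_eq ?_
      by_cases hi' : i = ℓ
      · subst hi'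
        have hadj : ∀ u : InNbr G (some i), ∃ j : Fin n, u.1 = some j := by
          rintro ⟨_ | j, hj⟩
          · exact absurd hj hℓ
          · exact ⟨j, rfl⟩
        choose f hf using hadj
        have hfinj : Function.Injective f := fun u v huv => Subtype.ext (by rw [hf, hf, huv])
        refine eq_of_dotProduct_enc_eq hk.le hkd (Finset.univ.image fun u => x (f u)) ?_
          fun y hy => ?_
        · exact le_of_eq (by rw [Finset.card_image_of_injective _ (f := fun u => x (f u))
            (hx.comp hfinj), Finset.card_univ, ← Protocol.inDeg_eq_card, hd])
        · obtain ⟨u, -, rfl⟩ := Finset.mem_image.1 hy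
          have hu : G.Adj (some (f u)) (some i) := hf u ▸ u.2
          have hne : f u ≠ i := fun h => hG (some i) (h ▸ hu)
          -- All in-neighbours of `ℓ` hear from the dealer in round 0 and send in round 1, which
          -- exists because n + 1 ≥ 2.
          have h1 : sent G x ω 1 i ⟨some (f u), hu⟩ = sent G x ω' 1 i ⟨some (f u), hu⟩ :=
            congrFun (congrFun (h i hi) ⟨some (f u), hu⟩) (⟨1, by omega⟩ : Fin (n + 1))
          rw [sent_of_adj _ _ _ (hD _ hne), sent_of_adj _ _ _ (hD _ hne)] at h1
          simp only [if_true, Option.some.injEq, Sum.inr.injEq] at h1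
          rw [symbolAt_comm ω, symbolAt_comm ω'] at h1
          exact h1
      · have h1 : sent G x ω 0 i ⟨none, hD i hi'⟩ = sent G x ω' 0 i ⟨none, hD i hi'⟩ :=
          congrFun (congrFun (h i hi) ⟨none, hD i hi'⟩) (0 : Fin (n + 1))
        rw [sent_none, sent_none] at h1
        simpa using h1
    exact ⟨decode, fun ω _ => h ω⟩
  secrecy J hJ := by
    refine (protocol G k d x).indep_of_equiv (uniformLaw_mem _).2 _ fun s s' => ?_
    obtain ⟨e, he⟩ := exists_translate_rowAt_eq hx0 hJ s s'
    refine ⟨e, fun _ => rfl, fun r c => funext fun j => Prod.ext rfl ?_⟩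
    funext u t
    exact congrFun (sent_eq_of_row_eq (G := G) hk.le hkd hx (he r c j.1 j.2) t) u

/-! ### Amount of downloaded data -/

omit [Field F] in
theorem log_card_secret (hkd : k ≤ d) :
    Real.log (Fintype.card (Secret F k d)) = ((d : ℝ) - k + 1) * Real.log (Fintype.card F) := by
  rw [Fintype.card_fun, Fintype.card_fin]
  push_cast [Nat.cast_sub hkd]
  rw [Real.log_pow]
  push_cast [Nat.cast_sub hkd]
  ring

theorem log_card_pos : 0 < Real.log (Fintype.card F) :=
  Real.log_pos (by exact_mod_cast Fintype.one_lt_card)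

theorem sum_log_div (hkd : k ≤ d) {ι : Type*} [Fintype ι] (hι : Fintype.card ι = d) {f : ι → ℝ}
    (hf : ∀ i, f i = Real.log (Fintype.card F)) :
    (∑ i, f i) / Real.log (Fintype.card (Secret F k d)) = (d : ℝ) / ((d : ℝ) - k + 1) := by
  have h := log_card_pos (F := F)
  have h1 : (k : ℝ) ≤ d := by exact_mod_cast hkd
  have h2 : (0 : ℝ) < (d : ℝ) - k + 1 := by linarith
  simp only [hf, Finset.sum_const, Finset.card_univ, hι, nsmul_eq_mul]
  rw [log_card_secret hkd]
  field_simp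

/-- The translations of the secret act on the outcomes. -/
def shiftSecret (s₀ : Secret F k d) : Out F n k d ≃ Out F n k d :=
  (Equiv.addRight s₀).prodCongr (Equiv.refl _)

omit [Fintype F] in
theorem symbolAt_shift (s₀ : Secret F k d) (ω : Out F n k d) (j i : Fin n) :
    symbolAt x (shiftSecret s₀ ω) j i =
      symbolAt x ω j i + row s₀ 0 (x j) ⬝ᵥ enc k d (x i) := by
  rw [symbolAt, symbolAt, rowAt, rowAt, ← add_dotProduct, ← row_add]
  rfl

/-- A variable that is an injective image of `Z`, where symmetries of the probability space act on
`Z` by all translations. -/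
theorem entropy_and_range_of_shift {Ω α β : Type*} [Fintype Ω] [Fintype α] [Fintype β]
    [AddCommGroup α] {p : Ω → ℝ} (hp : p ∈ stdSimplex ℝ Ω) (Z : Ω → α)
    (h : ∀ a, ∃ e : Ω ≃ Ω, (∀ ω, p (e ω) = p ω) ∧ ∀ ω, Z (e ω) = Z ω + a)
    {g : α → β} (hg : Function.Injective g) {X : Ω → β} (hX : ∀ ω, X ω = g (Z ω)) :
    shannonEntropy p X = Real.log (Fintype.card α) ∧
      Set.ncard (Set.range X) = Fintype.card α := by
  obtain rfl : X = fun ω => g (Z ω) := funext hX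
  obtain ⟨ω₀⟩ : Nonempty Ω := by
    by_contra h
    rw [not_nonempty_iff] at h
    simpa using hp.2
  constructor
  · rw [shannonEntropy_comp_injective hp.1 _ hg]
    refine shannonEntropy_of_transitive hp.2 _ fun y z => ?_
    obtain ⟨e, he, hZ⟩ := h (z - y)
    refine ⟨e, he, fun ω => ?_⟩
    rw [hZ, ← eq_sub_iff_add_eq, sub_sub_cancel]
  · have hZ : Function.Surjective Z := fun a => by
      obtain ⟨e, -, he⟩ := h (a - Z ω₀)
      exact ⟨e ω₀, by rw [he, add_sub_cancel]⟩
    rw [show (fun ω => g (Z ω)) = g ∘ Z from rfl, hZ.range_comp, ← Set.image_univ,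
      Set.ncard_image_of_injective _ hg, Set.ncard_univ, Nat.card_eq_fintype_card]

open scoped Classical in
include hk hkn hkd in
theorem protocol_download (hG : ∀ v, ¬ G.Adj v v)
    (hℓ : ¬ G.Adj none (some ℓ)) (hD : ∀ i, i ≠ ℓ → G.Adj none (some i)) (hd : inDeg G ℓ = d) :
    (protocol G k d x).download (uniformLaw (Secret F k d)) ℓ = (d : ℝ) / ((d : ℝ) - k + 1) ∧
      (protocol G k d x).sizeDownload ℓ = (d : ℝ) / ((d : ℝ) - k + 1) := by
  have h : ∀ u : InNbr G (some ℓ),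
      shannonEntropy ((protocol G k d x).prob (uniformLaw (Secret F k d)))
        (fun ω => (protocol G k d x).transcript ω (some ℓ) u) = Real.log (Fintype.card F) ∧
      Set.ncard (Set.range fun ω : (protocol G k d x).Outcome =>
        (protocol G k d x).transcript ω (some ℓ) u) = Fintype.card F := by
    rintro ⟨_ | j, hj⟩
    · exact absurd hj hℓ
    have hne : j ≠ ℓ := fun h => hG (some ℓ) (h ▸ hj)
    refine entropy_and_range_of_shift ((protocol G k d x).prob_mem (uniformLaw_mem _))
      (fun ω => symbolAt x ω j ℓ) (fun a => ?_)
      -- The transcript of the edge is one symbol in round 1 and silence otherwise.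
      (g := fun z (t : Fin (n + 1)) => if t.1 = 1 then (some (.inr z) : Msg F k d) else none)
      (fun z z' hz => ?_) fun ω => ?_
    · obtain ⟨s₀, hs₀⟩ := exists_row_dotProduct_eq (k := k) (d := d) (x j) (x ℓ) a
      refine ⟨shiftSecret s₀, fun _ => rfl, fun ω => ?_⟩
      rw [← hs₀]
      exact symbolAt_shift s₀ ω j ℓ
    · have := congrFun hz ⟨1, by omega⟩
      simpa using this
    · funext t
      exact sent_of_adj ω t hj (hD j hne)
  have hcard : Fintype.card (InNbr G (some ℓ)) = d := by rw [← Protocol.inDeg_eq_card, hd]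
  constructor
  · rw [Protocol.download, shannonEntropy_uniformLaw]
    exact sum_log_div hkd hcard fun u => (h u).1
  · rw [Protocol.sizeDownload]
    exact sum_log_div hkd hcard fun u => by rw [(h u).2]

/-! ### The protocol without relaying -/

theorem direct_transcript_dealer (ω : Out F n k d) (i : Fin n) (h : G.Adj none (some i)) :
    (directProtocol G k d x).transcript ω (some i) ⟨none, h⟩ =
      fun _ => some (share ω.1 ω.2.1 (x i)) := by
  funext (t : Fin 1)
  rw [Subsingleton.elim t 0]
  rfl

include hk hx in
theorem direct_isSecretSharing (hx0 : ∀ i, x i ≠ 0) (hD : ∀ i, G.Adj none (some i)) :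
    (directProtocol G k d x).IsSecretSharing (uniformLaw (Secret F k d)) k where
  recovery K hK := by
    obtain ⟨decode, h⟩ := (directProtocol G k d x).exists_decode (K := K)
      fun (ω ω' : Out F n k d) h => by
      refine secret_eq_of_shares_eq hk hx hK fun i hi => ?_
      have h1 := ((direct_transcript_dealer ω i (hD i)).symm.trans
        (congrFun (h i hi) ⟨none, hD i⟩)).trans (direct_transcript_dealer ω' i (hD i))
      exact Option.some.inj (congrFun h1 (0 : Fin 1))
    exact ⟨decode, fun ω _ => h ω⟩
  secrecy J hJ := by
    refine (directProtocol G k d x).indep_of_equiv (uniformLaw_mem _).2 _ fun s s' => ?_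
    obtain ⟨e, he⟩ := exists_translate_rowAt_eq hx0 hJ s s'
    refine ⟨e, fun _ => rfl, fun r c => funext fun j => Prod.ext rfl ?_⟩
    funext ⟨u, hu⟩
    rcases u with _ | i
    · refine (direct_transcript_dealer _ _ hu).trans
        (Eq.trans ?_ (direct_transcript_dealer _ _ hu).symm)
      rw [share_eq_of_row_eq (he r c j.1 j.2)]
      rfl
    · rfl

open scoped Classical in
include hkd in
theorem direct_download (hℓ : G.Adj none (some ℓ)) :
    (directProtocol G k d x).download (uniformLaw (Secret F k d)) ℓ = 1 ∧
      (directProtocol G k d x).sizeDownload ℓ = 1 := by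
  have hp := (directProtocol G k d x).prob_mem (uniformLaw_mem (Secret F k d))
  have h0 : Real.log (Fintype.card (Secret F k d)) ≠ 0 := by
    have h1 : (k : ℝ) ≤ d := by exact_mod_cast hkd
    rw [log_card_secret hkd]
    exact (mul_pos (by linarith) log_card_pos).ne'
  have hcard : Fintype.card (Unit ⊕ Fin (d - k) → F) = Fintype.card (Secret F k d) := by
    simp [add_comm]
  have h := entropy_and_range_of_shift hp
    (fun ω : Out F n k d => share ω.1 ω.2.1 (x ℓ)) (fun a => by
      obtain ⟨s₀, hs₀⟩ := exists_share_eq (k := k) (x ℓ) a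
      refine ⟨shiftSecret s₀, fun _ => rfl, fun ω => ?_⟩
      rw [← hs₀, ← share_add]
      rfl)
    (g := fun z (_ : Fin 1) => (some z : Option (Unit ⊕ Fin (d - k) → F)))
    (fun z z' hz => Option.some.inj (congrFun hz 0))
    (fun ω => direct_transcript_dealer ω ℓ hℓ)
  rw [hcard] at h
  -- Edges from participants carry constant silence and contribute 0 to both measures.
  have hne : ∀ u : InNbr G (some ℓ), u ≠ ⟨none, hℓ⟩ → ∀ ω,
      (directProtocol G k d x).transcript ω (some ℓ) u = fun _ => none := by
    rintro ⟨_ | j, hj⟩ hu ω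
    · exact absurd rfl hu
    · rfl
  constructor
  · rw [Protocol.download, shannonEntropy_uniformLaw, Finset.sum_eq_single ⟨none, hℓ⟩ _ (by simp),
      div_eq_one_iff_eq h0]
    · exact h.1
    · intro u _ hu
      simp only [hne u hu]
      exact shannonEntropy_const hp.2 _
  · rw [Protocol.sizeDownload, Finset.sum_eq_single ⟨none, hℓ⟩ _ (by simp), div_eq_one_iff_eq h0]
    · exact congrArg (fun N : ℕ => Real.log N) h.2
    · intro u _ hu
      simp only [hne u hu]
      have : Nonempty (directProtocol G k d x).Outcome := ⟨((0, 0, fun _ => ()) : Out F n k d)⟩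
      have h1 : Set.ncard (Set.range fun (_ : (directProtocol G k d x).Outcome)
          (_ : Fin (directProtocol G k d x).rounds) =>
            (none : (directProtocol G k d x).Msg)) = 1 := by
        rw [Set.range_const, Set.ncard_singleton]
      refine (congrArg (fun N : ℕ => Real.log N) h1).trans ?_
      rw [Nat.cast_one, Real.log_one]

end

end Sneak

end

/-! ### The main theorem -/

open scoped Classical in
theorem mainTheorem4 (n k : ℕ) (hk : 1 < k) (hkn : k ≤ n)
    (G : Digraph (Node n)) (hG : ∀ v, ¬ G.Adj v v) (ℓ : Fin n) :
    -- the lower bounds, for every secret with positive entropy and every protocol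
    (∀ (A : Type) [Fintype A] (μ : A → ℝ), μ ∈ stdSimplex ℝ A → 0 < shannonEntropy μ id →
      ∀ P : Protocol G A,
        (¬ G.Adj none (some ℓ) → k ≤ inDeg G ℓ → P.IsSecretSharing μ k →
          (inDeg G ℓ : ℝ) / ((inDeg G ℓ : ℝ) - k + 1) ≤ P.download μ ℓ) ∧
        (G.Adj none (some ℓ) → P.IsSecretSharing μ k → 1 ≤ P.download μ ℓ) ∧
        (¬ G.Adj none (some ℓ) → inDeg G ℓ < k → ¬ P.IsSecretSharing μ k)) ∧
    -- given only the neighbourhood of `ℓ`, they are attained on some graph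
    (∃ G' : Digraph (Node n), (∀ v, ¬ G'.Adj v v) ∧
      (∀ u, G'.Adj u (some ℓ) ↔ G.Adj u (some ℓ)) ∧
      (∀ u, G'.Adj (some ℓ) u ↔ G.Adj (some ℓ) u) ∧
      ∀ (F : Type) [Field F] [Fintype F] (x : Fin n → F),
        Function.Injective x → (∀ i, x i ≠ 0) →
        (¬ G.Adj none (some ℓ) → ∀ d : ℕ, d = inDeg G ℓ → k ≤ d →
          (Sneak.protocol G' k d x).IsSecretSharing (uniformLaw (Sneak.Secret F k d)) k ∧
          (Sneak.protocol G' k d x).download (uniformLaw (Sneak.Secret F k d)) ℓ =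
            (d : ℝ) / ((d : ℝ) - k + 1) ∧
          (Sneak.protocol G' k d x).sizeDownload ℓ = (d : ℝ) / ((d : ℝ) - k + 1)) ∧
        (G.Adj none (some ℓ) → ∀ d : ℕ, k ≤ d →
          (Sneak.directProtocol G' k d x).IsSecretSharing
            (uniformLaw (Sneak.Secret F k d)) k ∧
          (Sneak.directProtocol G' k d x).download (uniformLaw (Sneak.Secret F k d)) ℓ = 1 ∧
          (Sneak.directProtocol G' k d x).sizeDownload ℓ = 1)) := by
  refine ⟨fun A _ μ hμ h0 P => ⟨fun hD hd hP => P.le_download_of_not_adj hμ h0 hk hG hP hD hd,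
    fun _ hP => P.one_le_download hμ h0 hk hkn hP ℓ,
    fun hD hd => P.not_isSecretSharing_of_inDeg_lt hμ h0 hkn hG hD hd⟩, ?_⟩
  -- Away from `ℓ` only the edges from the dealer to the other participants remain, so every
  -- participant except possibly `ℓ` is adjacent to the dealer.
  let G' : Digraph (Node n) :=
    ⟨fun u v => if u = some ℓ ∨ v = some ℓ then G.Adj u v else u = none ∧ v ≠ none⟩
  have hG' : ∀ v, ¬ G'.Adj v v := fun v => by
    by_cases hv : v = some ℓ <;> simp [G', hv, hG]
  have hin : ∀ u, G'.Adj u (some ℓ) ↔ G.Adj u (some ℓ) := fun u => by simp [G']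
  have hout : ∀ u, G'.Adj (some ℓ) u ↔ G.Adj (some ℓ) u := fun u => by simp [G']
  have hdeal : ∀ i, i ≠ ℓ → G'.Adj none (some i) := fun i hi => by simp [G', hi]
  refine ⟨G', hG', hin, hout, fun F _ _ x hx hx0 => ⟨fun hD d hd hkd => ?_, fun hD d hkd => ?_⟩⟩
  · have hd' : inDeg G' ℓ = d := by rw [hd, inDeg, inDeg]; simp only [hin]
    have hD' : ¬ G'.Adj none (some ℓ) := by rwa [hin]
    exact ⟨Sneak.protocol_isSecretSharing hk hkn hkd hx hx0 hG' hD' hdeal hd',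
      Sneak.protocol_download hk hkn hkd hG' hD' hdeal hd'⟩
  · have hD' := (hin none).2 hD
    refine ⟨Sneak.direct_isSecretSharing hk hx hx0 fun i => ?_, Sneak.direct_download hkd hD'⟩
    by_cases hi : i = ℓ
    · rwa [hi]
    · exact hdeal i hi
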